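/- **Setting.** Let $p$ be a prime, let $k=\mathbb{Q}_p$ or $k=\mathbb{F}_p((T))$ with its $p$-adic absolute value $|\cdot|_p$ (so $|\pi|_p=p^{-1}$ for the uniformizer $\pi=p$, resp. $\pi=T$), and $\mathcal{O}_k=\{x\in k:|x|_p\le 1\}$. Let $V$ be a $k$-vector space of finite dimension $m>0$ with a basis $e_1,\dots,e_m$, and let $N:V\to\mathbb{R}$ be a norm: $N(v)\ge 0$ with equality iff $v=0$, $N(xv)=|x|_pN(v)$, $N(v+w)\le\max(N(v),N(w))$. For vectors $b_i$ write $\mathcal{L}(b_1,\dots,b_n)=\{\sum x_ib_i:x_i\in\mathcal{O}_k\}$; it is a lattice of rank $n$ if the $b_i$ are linearly independent over $k$. Put $\mathrm{dist}(t,L)=\inf_{v\in L}N(t-v)$, $M(\sum v_ie_i)=\max_i|v_i|_p$, $L_j=\mathcal{L}(e_i: i\ne j)$ and $$c_1=\frac1{\max_i N(e_i)},\qquad c_2=\frac1{\min_j\mathrm{dist}(e_j,L_j)}.$$ **Computability.** A *finite vector* is a vector $\sum_i v_ie_i$ whose coordinates are given as finite sums $v_i=\pi^{-t}\sum_{l}d_l\pi^l$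 with $t\in\mathbb{N}$, $d_l\in\mathbb{Z}$. A real number $f=f(k,V,e,N)\geq 0$ is *computable from the norm* if there is one oracle algorithm, the same for all $p,k,m,V,e,N$, which, on input $p$, $m$ and $r\in\mathbb{N}$ and with access to any procedure that for a finite vector $v$ and $s\in\mathbb{N}$ returns $a\in\mathbb{N}$ with $|a/2^s-N(v)|\le 2^{-s}$, halts and returns $a\in\mathbb{N}$ with $|a/2^r-f|\le2^{-r}$. **Theorem.** 1. $M$ is a norm on $V$; for each $j$ the distance $\mathrm{dist}(e_j,L_j)$ is attained at a vector of $L_j$; $c_1,c_2>0$; and $$c_1N(v)\le M(v)\le c_2N(v)\qquad\text{for all }v\in V.$$ 2. $c_1$ and $c_2$ are computable from the norm. 3. There is one oracle algorithm which, on input $p,m,j$ and with access to any procedure deciding $N(v)\le N(w)$ for finite vectors $v,w$, halts and returns a finite vector $v_0\in L_j$ with $N(e_j-v_0)=\mathrm{dist}(e_j,L_j)$, i.e. it solves this instance of the closest vector problem exactly. 4. Identify $V$ with $k^m$ by means of $e_1,\dots,e_m$, with $x\cdot y=\sum_i x_iy_i$. For a lattice $\Lambda=\mathcal{L}(b_1,\dots,b_n)$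 of rank $n\ge1$ put $\det\Lambda=|\det(b_i\cdot b_j)_{i,j}|_p^{1/2}$ and $\Lambda^*=\{y\in\mathrm{span}_k(\Lambda):y\cdot x\in\mathcal{O}_k\ \forall x\in\Lambda\}$. The successive maxima $\overline{\lambda_1}(\Lambda)\ge\dots\ge\overline{\lambda_n}(\Lambda)$ are the norms, in decreasing order, of the members of a basis $\alpha_1,\dots,\alpha_n$ of $\Lambda$ that is $N$-orthogonal, i.e. $N(\sum a_i\alpha_i)=\max_iN(a_i\alpha_i)$ for all $a_i\in k$. Then the constants $c=1/c_2$, $c'=1/c_2^2$ and, for each $n$, $c''=1/c_2^n$ are positive and computable from the norm, and for every lattice $\Lambda$ of rank $n\geq 1$: - $\Lambda$ has a vector of largest norm, and this norm $\lambda_1$ satisfies $\lambda_1\ge c\,(\det\Lambda)^{1/n}$; - $\overline{\lambda_1}(\Lambda)\cdot\overline{\lambda_n}(\Lambda^*)\ge c'$ whenever $\Lambda^*$ is a lattice of rank $n$ (which is the case iff $\det\Lambda\neq0$); - $\prod_{i=1}^n\overline{\lambda_i}(\Lambda)\ge c''\det\Lambda$. The last two inequalities hold for the norms of any $N$-orthogonal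 bases, so whatever $N$-orthogonal bases are used to define the successive maxima. -/

import Mathlib

universe u

noncomputable section

/-! ### The two kinds of base field `ℚ_p` and `𝔽_p((T))` -/

/-- Which of the two families of local fields is meant. -/
inductive LocalKind
  | padic
  | laurent

/-- The field `k`: either `ℚ_p` or `𝔽_p((T))`. -/
def LocalKind.Carrier (F : LocalKind) (p : ℕ) [Fact p.Prime] : Type :=
  match F with
  | .padic => ℚ_[p]
  | .laurent => LaurentSeries (ZMod p)

instance LocalKind.instField (F : LocalKind) (p : ℕ) [Fact p.Prime] : Field (F.Carrier p) :=
  match F with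
  | .padic => inferInstanceAs (Field ℚ_[p])
  | .laurent => inferInstanceAs (Field (LaurentSeries (ZMod p)))

/-- The `p`-adic absolute value on `𝔽_p((T))`: `p ^ (-t)` if `t` is the order of `f ≠ 0`. -/
def laurentAbs (p : ℕ) (f : LaurentSeries (ZMod p)) : ℝ :=
  open Classical in if f = 0 then 0 else (p : ℝ) ^ (-(HahnSeries.order f))

/-- The `p`-adic absolute value on `k`. -/
def LocalKind.abv (F : LocalKind) (p : ℕ) [Fact p.Prime] : F.Carrier p → ℝ :=
  match F with
  | .padic => fun x : ℚ_[p] => ‖x‖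
  | .laurent => laurentAbs p

/-- The uniformizer of `k`: `p` in `ℚ_p`, and `T` in `𝔽_p((T))`. -/
def LocalKind.unif (F : LocalKind) (p : ℕ) [Fact p.Prime] : F.Carrier p :=
  match F with
  | .padic => (p : ℚ_[p])
  | .laurent => (HahnSeries.single (1 : ℤ) (1 : ZMod p) : LaurentSeries (ZMod p))

/-! ### Norms, lattices, distances -/

section Generic

variable {k V : Type*} [Field k] [AddCommGroup V] [Module k V]

/-- A (non-archimedean) norm on a vector space over `(k, |·|)`. -/
structure IsUltraNorm (abv : k → ℝ) (N : V → ℝ) : Prop where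
  nonneg : ∀ v, 0 ≤ N v
  eq_zero_iff : ∀ v, N v = 0 ↔ v = 0
  smul : ∀ (x : k) (v : V), N (x • v) = abv x * N v
  add_le_max : ∀ v w, N (v + w) ≤ max (N v) (N w)

/-- `𝓛(b) = {∑ xᵢ bᵢ : xᵢ ∈ 𝓞_k}`, where `𝓞_k = {x : |x| ≤ 1}`. -/
def latticeSpan (abv : k → ℝ) {ι : Type} [Fintype ι] (b : ι → V) : Set V :=
  {v | ∃ x : ι → k, (∀ i, abv (x i) ≤ 1) ∧ v = ∑ i, x i • b i}

/-- The distance from `t` to a set `L` with respect to `N`. -/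
def normDist (N : V → ℝ) (t : V) (L : Set V) : ℝ :=
  sInf ((fun v => N (t - v)) '' L)

/-- `α₁, …, αₙ` is an `N`-orthogonal basis of the lattice `L`. -/
structure IsOrthogonalLatticeBasis (abv : k → ℝ) (N : V → ℝ) (L : Set V) {n : ℕ}
    (α : Fin n → V) : Prop where
  linearIndependent : LinearIndependent k α
  span_eq : L = latticeSpan abv α
  orthogonal : ∀ a : Fin n → k, N (∑ i, a i • α i) = ⨆ i, N (a i • α i)

/-- `lam 0 ≥ lam 1 ≥ …` are the successive maxima of the rank-`n` lattice `L` with respect to `N`,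
that is, the norms, in decreasing order, of the members of an `N`-orthogonal basis of `L`. -/
def IsSuccessiveMaxima (abv : k → ℝ) (N : V → ℝ) (L : Set V) {n : ℕ} (lam : Fin n → ℝ) : Prop :=
  ∃ α : Fin n → V, IsOrthogonalLatticeBasis abv N L α ∧ (∀ i, lam i = N (α i)) ∧ Antitone lam

end Generic

/-! ### The objects of the theorem -/

/-- A vector space `V` of finite dimension `m > 0` over `k = ℚ_p` or `k = 𝔽_p((T))`, with a
basis `e₁, …, e_m` and a norm `N`. -/
structure NormedSetting where
  F : LocalKind
  p : ℕ
  [prime : Fact p.Prime]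
  m : ℕ
  m_pos : 0 < m
  V : Type u
  [addCommGroup : AddCommGroup V]
  [module : Module (F.Carrier p) V]
  e : Module.Basis (Fin m) (F.Carrier p) V
  N : V → ℝ
  isNorm : IsUltraNorm (F.abv p) N

attribute [instance] NormedSetting.prime NormedSetting.addCommGroup NormedSetting.module

namespace NormedSetting

variable (D : NormedSetting.{u})

/-- The base field. -/
abbrev K : Type := D.F.Carrier D.p

/-- Its absolute value. -/
abbrev abv : D.K → ℝ := D.F.abv D.p

/-- The coordinate max-norm `M(∑ vᵢ eᵢ) = maxᵢ |vᵢ|`. -/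
def M (v : D.V) : ℝ := ⨆ i, D.abv (D.e.repr v i)

/-- `𝓛(e₁, …, e_{j-1}, e_{j+1}, …, e_m)`. -/
def otherLattice (j : Fin D.m) : Set D.V :=
  latticeSpan D.abv (fun i : {i : Fin D.m // i ≠ j} => D.e i)

/-- `maxᵢ N(eᵢ)`. -/
def maxBasisNorm : ℝ := ⨆ i, D.N (D.e i)

/-- `minⱼ dist(eⱼ, 𝓛(e₁, …, e_{j-1}, e_{j+1}, …, e_m))`. -/
def minBasisDist : ℝ := ⨅ j, normDist D.N (D.e j) (D.otherLattice j)

/-- The constant `c₁ = 1 / maxᵢ N(eᵢ)`. -/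
def c₁ : ℝ := (D.maxBasisNorm)⁻¹

/-- The constant `c₂ = 1 / minⱼ dist(eⱼ, 𝓛(eᵢ : i ≠ j))`. -/
def c₂ : ℝ := (D.minBasisDist)⁻¹

/-- The constant `c = 1 / c₂` of the analogue of Minkowski's first theorem. -/
def cFirst : ℝ := 1 / D.c₂

/-- The constant `c' = 1 / c₂²` of the transference theorem. -/
def cTransfer : ℝ := 1 / D.c₂ ^ 2

/-- The constant `c'' = 1 / c₂ⁿ` of the analogue of Minkowski's second theorem, for rank `n`. -/
def cSecond (n : ℕ) : ℝ := 1 / D.c₂ ^ n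

/-- The dot product of the coordinate vectors. -/
def dot (v w : D.V) : D.K := ∑ i, D.e.repr v i * D.e.repr w i

/-- The determinant `|det(Bᵗ B)|^{1/2}` of the lattice with basis `B`. -/
def latticeDet {n : ℕ} (B : Fin n → D.V) : ℝ :=
  √(D.abv (Matrix.det (Matrix.of fun i j => D.dot (B i) (B j))))

/-- The dual lattice `{y ∈ span(L) : y · x ∈ 𝓞_k for all x ∈ L}`. -/
def dualLattice (L : Set D.V) : Set D.V :=
  {y | y ∈ Submodule.span D.K L ∧ ∀ x ∈ L, D.abv (D.dot y x) ≤ 1}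

end NormedSetting

/-! ### Computation relative to a norm -/

/-- A finite expansion `(t, [d₀, …, d_r])`, standing for `π ^ (-t) * (d₀ + d₁ π + … + d_r π ^ r)`. -/
abbrev FinScalar : Type := ℕ × List ℤ

/-- A list of finite expansions, standing for a coordinate vector; missing entries are read as `0`
and superfluous ones are ignored. -/
abbrev FinVector : Type := List FinScalar

/-- The element of `k` that a finite expansion stands for. -/
def FinScalar.eval (F : LocalKind) (p : ℕ) [Fact p.Prime] (a : FinScalar) : F.Carrier p :=
  F.unif p ^ (-(a.1 : ℤ)) *
    ∑ i ∈ Finset.range a.2.length, ((a.2.getD i 0 : ℤ) : F.Carrier p) * F.unif p ^ i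

/-- The vector of `V` whose coordinates in the basis `e` are given by finite expansions. -/
def NormedSetting.vec (D : NormedSetting.{u}) (x : FinVector) : D.V :=
  ∑ i : Fin D.m, FinScalar.eval D.F D.p (x.getD i (0, [])) • D.e i

/-- An algorithm with access to an oracle. On input `i`, when `l` is the list of the answers
received so far, it computes `next i l`, which is either its next query or its final output. -/
structure OracleAlgorithm (I Q A R : Type) [Primcodable I] [Primcodable Q] [Primcodable A]
    [Primcodable R] where
  next : I → List A → Q ⊕ R
  computable : Computable₂ next

section OracleAlgorithm

variable {I Q A R : Type} [Primcodable I] [Primcodable Q] [Primcodable A] [Primcodable R]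

/-- The run of the algorithm on input `i` with oracle `O` reaches the list of answers `l`. -/
inductive OracleAlgorithm.Reaches (𝒜 : OracleAlgorithm I Q A R) (O : Q → A) (i : I) :
    List A → Prop
  | start : OracleAlgorithm.Reaches 𝒜 O i []
  | ask (l : List A) (q : Q) : OracleAlgorithm.Reaches 𝒜 O i l → 𝒜.next i l = Sum.inl q →
      OracleAlgorithm.Reaches 𝒜 O i (l ++ [O q])

/-- The run of the algorithm on input `i` with oracle `O` halts with output `r`. -/
def OracleAlgorithm.Outputs (𝒜 : OracleAlgorithm I Q A R) (O : Q → A) (i : I) (r : R) : Prop :=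
  ∃ l, 𝒜.Reaches O i l ∧ 𝒜.next i l = Sum.inr r

end OracleAlgorithm

/-- `a / 2 ^ r` approximates `x` up to an error of `2 ^ (-r)`. -/
def IsDyadicApprox (x : ℝ) (r a : ℕ) : Prop := |(a : ℝ) / 2 ^ r - x| ≤ 1 / 2 ^ r

namespace NormedSetting

/-- The oracle computes `N`: asked for a vector and a precision, it returns a dyadic
approximation, of that precision, to the norm of the vector. -/
def IsNormOracle (D : NormedSetting.{u}) (O : FinVector × ℕ → ℕ) : Prop :=
  ∀ x r, IsDyadicApprox (D.N (D.vec x)) r (O (x, r))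

/-- The oracle compares values of `N`: asked for two vectors, it tells whether the norm of the
first is at most the norm of the second. -/
def IsNormComparison (D : NormedSetting.{u}) (O : FinVector × FinVector → Bool) : Prop :=
  ∀ x y, O (x, y) = true ↔ D.N (D.vec x) ≤ D.N (D.vec y)

/-- The constant `f`, which depends on the normed space with basis, is computable from the norm:
one algorithm, given `p`, the dimension `m`, a precision `r` and access to any procedure that
computes the norm, halts and returns an approximation of precision `r` to the constant. -/
def ComputableFromNorm (f : NormedSetting.{u} → ℝ) : Prop :=
  ∃ 𝒜 : OracleAlgorithm (ℕ × ℕ × ℕ) (FinVector × ℕ) ℕ ℕ,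
    ∀ (D : NormedSetting.{u}) (O : FinVector × ℕ → ℕ), D.IsNormOracle O →
      ∀ r : ℕ, ∃ a : ℕ, 𝒜.Outputs O (D.p, D.m, r) a ∧ IsDyadicApprox (f D) r a

end NormedSetting

end

/-! ### The absolute value of the base field -/

section LaurentAbs

variable {p : ℕ} [hp : Fact p.Prime]

/-! The bound by `c₁` is the ultrametric inequality applied to the coordinate expansion. For `c₂`,
divide `v` by its largest coordinate `v_j`: the result is `e_j` minus an element of `L_j`, so `N v /
|v_j|` is at least the distance of `e_j` from `L_j` (`M_le_c₂_mul`). That distance is attained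
because the ring of integers is compact, and it is positive because `e_j` is not in `L_j`.

The Minkowski-type bounds first hold for `M`, where Leibniz expansion and the ultrametric inequality
give a Hadamard inequality (`latticeDet_le_prod_M`); they pass to `N` through `M ≤ c₂ N`. For
transference, the last dual basis vector pairs with some `α i` to absolute value at least `1`, since
otherwise it could be divided by the uniformizer inside the dual lattice.

For computability, cutting a vector of `L_j` after `s` digits moves it by at most `p ^ (-s) * maxᵢ
N(eᵢ)`. Since `p ≥ 2`, this is a bounded error in units of `2 ^ (-s)`, so finitely many norms at
precision `s` estimate both extremal quantities. For the closest vector nothing is lost: once the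
cut is smaller than the distance, the ultrametric inequality makes the truncation itself closest,
and finitely many comparisons certify this. Searches of this kind become oracle algorithms by asking
all queries in the order of their codes (`exists_oracleAlgorithm_of_stages`). -/

theorem laurentAbs_le_zpow_iff (f : LaurentSeries (ZMod p)) (r : ℤ) :
    laurentAbs p f ≤ (p : ℝ) ^ (-r) ↔ ∀ n < r, f.coeff n = 0 := by
  have h1 : (1 : ℝ) < p := by exact_mod_cast hp.out.one_lt
  by_cases hf : f = 0
  · subst hf
    simp only [laurentAbs, if_true, HahnSeries.coeff_zero, implies_true, iff_true]
    positivity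
  · rw [laurentAbs, if_neg hf, zpow_le_zpow_iff_right₀ h1, neg_le_neg_iff,
      HahnSeries.le_order_iff_forall hf]

theorem laurentAbs_nonneg (f : LaurentSeries (ZMod p)) : 0 ≤ laurentAbs p f := by
  rw [laurentAbs]; split_ifs <;> positivity

theorem laurentAbs_eq_zero_iff (f : LaurentSeries (ZMod p)) : laurentAbs p f = 0 ↔ f = 0 := by
  have h0 : (p : ℝ) ≠ 0 := by exact_mod_cast hp.out.ne_zero
  rw [laurentAbs]; split_ifs with h <;> simp [h, h0, zpow_ne_zero]

theorem laurentAbs_mul (f g : LaurentSeries (ZMod p)) :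
    laurentAbs p (f * g) = laurentAbs p f * laurentAbs p g := by
  have h0 : (p : ℝ) ≠ 0 := by exact_mod_cast hp.out.ne_zero
  by_cases hf : f = 0
  · simp [laurentAbs, hf]
  by_cases hg : g = 0
  · simp [laurentAbs, hg]
  rw [laurentAbs, laurentAbs, laurentAbs, if_neg hf, if_neg hg, if_neg (mul_ne_zero hf hg),
    HahnSeries.order_mul hf hg, neg_add, zpow_add₀ h0]

theorem laurentAbs_eq_zpow {f : LaurentSeries (ZMod p)} (hf : f ≠ 0) :
    laurentAbs p f = (p : ℝ) ^ (-f.order) := by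
  rw [laurentAbs, if_neg hf]

theorem laurentAbs_add_le_max (f g : LaurentSeries (ZMod p)) :
    laurentAbs p (f + g) ≤ max (laurentAbs p f) (laurentAbs p g) := by
  have key : ∀ f g : LaurentSeries (ZMod p), laurentAbs p f ≤ laurentAbs p g →
      laurentAbs p (f + g) ≤ laurentAbs p g := by
    intro f g h
    by_cases hg : g = 0
    · have : f = 0 := by
        rw [← laurentAbs_eq_zero_iff (p := p)]
        exact le_antisymm (h.trans ((laurentAbs_eq_zero_iff g).2 hg).le) (laurentAbs_nonneg f)
      simp [this]
    · have hg' := (laurentAbs_le_zpow_iff g g.order).1 (laurentAbs_eq_zpow hg).le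
      rw [laurentAbs_eq_zpow hg] at h ⊢
      rw [laurentAbs_le_zpow_iff] at h ⊢
      intro n hn
      rw [HahnSeries.coeff_add, h n hn, hg' n hn, add_zero]
  rcases le_total (laurentAbs p f) (laurentAbs p g) with h | h
  · exact (key f g h).trans (le_max_right _ _)
  · rw [add_comm]; exact (key g f h).trans (le_max_left _ _)

end LaurentAbs

/-! ### Uniformizer, digits and compactness of the ring of integers -/

namespace LocalKind

variable (F : LocalKind) (p : ℕ) [hp : Fact p.Prime]

theorem isUltraNorm_abv : IsUltraNorm (V := F.Carrier p) (F.abv p) (F.abv p) := by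
  cases F
  · exact ⟨norm_nonneg (E := ℚ_[p]), fun x => norm_eq_zero (E := ℚ_[p]) (a := x),
      norm_mul (α := ℚ_[p]), Padic.nonarchimedean (p := p)⟩
  · exact ⟨laurentAbs_nonneg, laurentAbs_eq_zero_iff, laurentAbs_mul, laurentAbs_add_le_max⟩

theorem abv_unif : F.abv p (F.unif p) = (p : ℝ)⁻¹ := by
  cases F
  · exact Padic.norm_p
  · change laurentAbs p _ = _
    have h : (HahnSeries.single (1 : ℤ) (1 : ZMod p) : LaurentSeries (ZMod p)) ≠ 0 := by simp
    change laurentAbs p (HahnSeries.single (1 : ℤ) (1 : ZMod p)) = _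
    rw [laurentAbs_eq_zpow h, HahnSeries.order_single one_ne_zero, zpow_neg_one]

variable {F p}

/-- The valuation is discrete: its values are `0` and the integral powers of `p`. -/
theorem abv_le_inv_of_lt_one {x : F.Carrier p} (hx : F.abv p x < 1) :
    F.abv p x ≤ (p : ℝ)⁻¹ := by
  have h1 : (1 : ℝ) < p := by exact_mod_cast hp.out.one_lt
  cases F
  · have h := (Padic.norm_le_pow_iff_norm_lt_pow_add_one (p := p) x (-1)).2
      (by rw [neg_add_cancel, zpow_zero]; exact hx)
    rw [zpow_neg_one] at h
    exact h
  · change laurentAbs p x < 1 at hx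
    change laurentAbs p x ≤ _
    by_cases h : (x : LaurentSeries (ZMod p)) = 0
    · rw [(laurentAbs_eq_zero_iff _).2 h]; positivity
    · rw [laurentAbs_eq_zpow h] at hx ⊢
      rw [← zpow_zero (p : ℝ), zpow_lt_zpow_iff_right₀ h1] at hx
      rw [← zpow_neg_one, zpow_le_zpow_iff_right₀ h1]
      omega

/-- The residue field has `p` elements, represented by `0, …, p - 1`. For Laurent series the digit
is the constant coefficient. -/
theorem exists_digit {x : F.Carrier p} (hx : F.abv p x ≤ 1) :
    ∃ d < p, F.abv p (x - (d : F.Carrier p)) ≤ (p : ℝ)⁻¹ := by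
  cases F
  · obtain ⟨d, hd, h⟩ := PadicInt.exists_mem_range (p := p) (⟨x, hx⟩ : ℤ_[p])
    refine ⟨d, hd, abv_le_inv_of_lt_one (F := .padic) ?_⟩
    rw [PadicInt.maximalIdeal_eq_span_p, Ideal.mem_span_singleton,
      ← PadicInt.norm_lt_one_iff_dvd] at h
    exact h
  · let f : LaurentSeries (ZMod p) := x
    have hf : ∀ n < 0, f.coeff n = 0 := (laurentAbs_le_zpow_iff f 0).1
      (by rw [neg_zero, zpow_zero]; exact hx)
    refine ⟨(f.coeff 0).val, ZMod.val_lt _, ?_⟩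
    change laurentAbs p (f - ((f.coeff 0).val : LaurentSeries (ZMod p))) ≤ _
    rw [← zpow_neg_one, laurentAbs_le_zpow_iff]
    have hc : (((f.coeff 0).val : ℕ) : LaurentSeries (ZMod p)) = HahnSeries.C (f.coeff 0) := by
      rw [← map_natCast HahnSeries.C, ZMod.natCast_zmod_val]
    intro n hn
    rw [HahnSeries.coeff_sub, hc]
    rcases (Int.lt_add_one_iff.1 hn : n ≤ 0).lt_or_eq with h | rfl
    · rw [hf n h, HahnSeries.C_apply, HahnSeries.coeff_single_of_ne h.ne, sub_zero]
    · rw [HahnSeries.C_apply, HahnSeries.coeff_single_same, sub_self]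

variable (F p)

/-- The ring of integers is a continuous image of a compact space. -/
theorem exists_compact_parametrization :
    ∃ (X : Type) (_ : TopologicalSpace X) (_ : CompactSpace X) (Φ : X → F.Carrier p),
      Set.range Φ = {x | F.abv p x ≤ 1} ∧
      ∀ x, ∀ ε > 0, ∀ᶠ y in nhds x, F.abv p (Φ y - Φ x) < ε := by
  have h1 : (1 : ℝ) < p := by exact_mod_cast hp.out.one_lt
  cases F
  · refine ⟨ℤ_[p], inferInstance, inferInstance, fun x => (x : ℚ_[p]), Subtype.range_coe, ?_⟩
    intro x ε hε
    filter_upwards [Metric.ball_mem_nhds x hε] with y hy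
    rw [mem_ball_iff_norm, PadicInt.norm_def] at hy
    exact hy
  -- Integral Laurent series are sequences in the finite set `ZMod p`, a compact product; agreement
  -- of the first `r` coefficients bounds the difference by `p ^ (-r)`.
  · let Φ : (ℕ → ZMod p) → LaurentSeries (ZMod p) :=
      fun a => HahnSeries.ofPowerSeries ℤ (ZMod p) (PowerSeries.mk a)
    have hneg : ∀ a, ∀ n < 0, (Φ a).coeff n = 0 := by
      intro a n hn
      refine HahnSeries.embDomain_of_notMem_range ?_
      rintro ⟨m, rfl⟩
      exact absurd hn (by simp)
    have hnat : ∀ a (n : ℕ), (Φ a).coeff n = a n := by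
      intro a n
      change (HahnSeries.ofPowerSeries ℤ (ZMod p) _).coeff _ = _
      rw [HahnSeries.ofPowerSeries_apply_coeff, PowerSeries.coeff_mk]
    refine ⟨ℕ → ZMod p, inferInstance, inferInstance, Φ, ?_, ?_⟩
    · ext f
      have hf := laurentAbs_le_zpow_iff (p := p) f 0
      rw [neg_zero, zpow_zero] at hf
      refine Iff.trans ?_ hf.symm
      constructor
      · rintro ⟨a, rfl⟩
        exact hneg a
      · intro h
        refine ⟨fun n => HahnSeries.coeff (f : LaurentSeries (ZMod p)) n, HahnSeries.ext ?_⟩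
        funext n
        rcases lt_or_ge n 0 with hn | hn
        · rw [hneg _ n hn]; exact (h n hn).symm
        · lift n to ℕ using hn
          exact hnat _ n
    · intro a ε hε
      obtain ⟨r, hr⟩ := exists_pow_lt_of_lt_one hε (inv_lt_one_of_one_lt₀ h1)
      have hev : ∀ᶠ b in nhds a, ∀ n ∈ Finset.range r, b n = a n := by
        rw [Filter.eventually_all_finset]
        intro n _
        exact (continuous_apply (A := fun _ => ZMod p) n).continuousAt.eventually
          (p := fun y => y = a n) (discreteTopology_iff_singleton_mem_nhds.1 inferInstance (a n))
      filter_upwards [hev] with b hb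
      refine lt_of_le_of_lt (?_ : laurentAbs p (Φ b - Φ a) ≤ (p : ℝ) ^ (-(r : ℤ))) ?_
      · rw [laurentAbs_le_zpow_iff]
        intro n hn
        rw [HahnSeries.coeff_sub]
        rcases lt_or_ge n 0 with h | h
        · rw [hneg _ n h, hneg _ n h, sub_zero]
        · lift n to ℕ using h
          rw [hnat, hnat, hb n (by simpa using hn), sub_self]
      · rwa [zpow_neg, zpow_natCast, ← inv_pow]

end LocalKind

/-! ### Multiplicativity of the absolute value -/

namespace LocalKind

variable (F : LocalKind) (p : ℕ) [hp : Fact p.Prime]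

/-- The absolute value of the base field, bundled. -/
noncomputable def absValue : AbsoluteValue (F.Carrier p) ℝ where
  toFun := F.abv p
  map_mul' := (F.isUltraNorm_abv p).smul
  nonneg' := (F.isUltraNorm_abv p).nonneg
  eq_zero' := (F.isUltraNorm_abv p).eq_zero_iff
  add_le' x y := ((F.isUltraNorm_abv p).add_le_max x y).trans
    (max_le_add_of_nonneg ((F.isUltraNorm_abv p).nonneg x) ((F.isUltraNorm_abv p).nonneg y))

variable {F p}

theorem abv_nonneg (x : F.Carrier p) : 0 ≤ F.abv p x := (F.absValue p).nonneg x

theorem abv_zero : F.abv p 0 = 0 := (F.absValue p).map_zero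

theorem abv_one : F.abv p 1 = 1 := (F.absValue p).map_one

theorem abv_neg (x : F.Carrier p) : F.abv p (-x) = F.abv p x := (F.absValue p).map_neg x

theorem abv_mul (x y : F.Carrier p) : F.abv p (x * y) = F.abv p x * F.abv p y :=
  (F.absValue p).map_mul x y

theorem abv_pow (x : F.Carrier p) (n : ℕ) : F.abv p (x ^ n) = F.abv p x ^ n :=
  (F.absValue p).map_pow x n

theorem abv_inv (x : F.Carrier p) : F.abv p x⁻¹ = (F.abv p x)⁻¹ := map_inv₀ (F.absValue p) x

theorem abv_prod {ι : Type*} (s : Finset ι) (f : ι → F.Carrier p) :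
    F.abv p (∏ i ∈ s, f i) = ∏ i ∈ s, F.abv p (f i) := map_prod (F.absValue p) f s

end LocalKind

/-! ### Consequences of the ultrametric inequality -/

namespace IsUltraNorm

variable {F : LocalKind} {p : ℕ} [hp : Fact p.Prime] {V : Type*} [AddCommGroup V]
  [Module (F.Carrier p) V] {N : V → ℝ}

theorem map_zero (hN : IsUltraNorm (F.abv p) N) : N 0 = 0 := (hN.eq_zero_iff 0).2 rfl

theorem map_neg (hN : IsUltraNorm (F.abv p) N) (v : V) : N (-v) = N v := by
  rw [← neg_one_smul (F.Carrier p) v, hN.smul, LocalKind.abv_neg, LocalKind.abv_one, one_mul]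

theorem map_sub_rev (hN : IsUltraNorm (F.abv p) N) (v w : V) : N (v - w) = N (w - v) := by
  rw [← hN.map_neg, neg_sub]

theorem sub_le_max (hN : IsUltraNorm (F.abv p) N) (v w : V) : N (v - w) ≤ max (N v) (N w) := by
  simpa [sub_eq_add_neg, hN.map_neg] using hN.add_le_max v (-w)

theorem pos (hN : IsUltraNorm (F.abv p) N) {v : V} (hv : v ≠ 0) : 0 < N v :=
  lt_of_le_of_ne (hN.nonneg v) fun h => hv ((hN.eq_zero_iff v).1 h.symm)

theorem sum_le (hN : IsUltraNorm (F.abv p) N) {ι : Type*} (s : Finset ι) (f : ι → V) {C : ℝ} (hC : 0 ≤ C)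
    (h : ∀ i ∈ s, N (f i) ≤ C) : N (∑ i ∈ s, f i) ≤ C := by
  classical
  induction s using Finset.induction_on with
  | empty => simpa [hN.map_zero] using hC
  | insert a s ha ih =>
    rw [Finset.sum_insert ha]
    exact (hN.add_le_max _ _).trans (max_le (h a (Finset.mem_insert_self a s))
      (ih fun i hi => h i (Finset.mem_insert_of_mem hi)))

theorem sub_le_norm_sub (hN : IsUltraNorm (F.abv p) N) (v w : V) : N v - N w ≤ N (v - w) := by
  have h := hN.add_le_max (v - w) w
  rw [sub_add_cancel] at h
  have := h.trans (max_le_add_of_nonneg (hN.nonneg _) (hN.nonneg _))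
  linarith

theorem abs_sub_le_norm_sub (hN : IsUltraNorm (F.abv p) N) (v w : V) : |N v - N w| ≤ N (v - w) :=
  abs_sub_le_iff.2 ⟨hN.sub_le_norm_sub v w, hN.map_sub_rev v w ▸ hN.sub_le_norm_sub w v⟩

theorem le_of_mem_latticeSpan (hN : IsUltraNorm (F.abv p) N) {ι : Type} [Fintype ι] {b : ι → V} {C : ℝ} (hC : 0 ≤ C)
    (hb : ∀ i, N (b i) ≤ C) {v : V} (hv : v ∈ latticeSpan (F.abv p) b) : N v ≤ C := by
  obtain ⟨x, hx, rfl⟩ := hv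
  refine hN.sum_le _ _ hC fun i _ => ?_
  rw [hN.smul]
  exact (mul_le_of_le_one_left (hN.nonneg _) (hx i)).trans (hb i)

end IsUltraNorm

theorem LocalKind.mem_latticeSpan {F : LocalKind} {p : ℕ} [Fact p.Prime] {V : Type*}
    [AddCommGroup V] [Module (F.Carrier p) V] {ι : Type} [Fintype ι] (b : ι → V) (i : ι) :
    b i ∈ latticeSpan (F.abv p) b := by
  classical
  refine ⟨Pi.single i 1, fun l => ?_, ?_⟩
  · rcases eq_or_ne l i with rfl | h
    · rw [Pi.single_eq_same, LocalKind.abv_one]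
    · rw [Pi.single_eq_of_ne h, LocalKind.abv_zero]; exact zero_le_one
  · rw [Finset.sum_eq_single i]
    · simp
    · intro l _ h; simp [h]
    · simp

namespace LocalKind

variable {F : LocalKind} {p : ℕ} [hp : Fact p.Prime]

theorem abv_sum_le {ι : Type*} (s : Finset ι) (f : ι → F.Carrier p) {C : ℝ} (hC : 0 ≤ C)
    (h : ∀ i ∈ s, F.abv p (f i) ≤ C) : F.abv p (∑ i ∈ s, f i) ≤ C :=
  (F.isUltraNorm_abv p).sum_le s f hC h

theorem abv_sub_le_max (x y : F.Carrier p) : F.abv p (x - y) ≤ max (F.abv p x) (F.abv p y) :=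
  (F.isUltraNorm_abv p).sub_le_max x y

theorem abv_natCast_le_one (n : ℕ) : F.abv p (n : F.Carrier p) ≤ 1 := by
  have h := abv_sum_le (F := F) (p := p) (Finset.range n) (fun _ => 1) zero_le_one
    fun _ _ => abv_one.le
  simpa using h

theorem abv_intCast_le_one (n : ℤ) : F.abv p (n : F.Carrier p) ≤ 1 := by
  obtain ⟨n, rfl | rfl⟩ := n.eq_nat_or_neg
  · simpa using abv_natCast_le_one n
  · simpa [abv_neg] using abv_natCast_le_one n

/-- In the Leibniz formula the signs have absolute value at most `1`, and an ultrametric sum is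
bounded by its largest term. -/
theorem abv_det_le {n : ℕ} (A : Matrix (Fin n) (Fin n) (F.Carrier p)) {C : ℝ} (hC : 0 ≤ C)
    (h : ∀ σ : Equiv.Perm (Fin n), ∏ i, F.abv p (A (σ i) i) ≤ C) : F.abv p A.det ≤ C := by
  rw [Matrix.det_apply']
  refine abv_sum_le _ _ hC fun σ _ => ?_
  rw [abv_mul, abv_prod]
  exact (mul_le_of_le_one_left (Finset.prod_nonneg fun i _ => abv_nonneg _)
    (abv_intCast_le_one _)).trans (h σ)

end LocalKind

namespace NormedSetting

open LocalKind

variable (D : NormedSetting.{u})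

instance : Nonempty (Fin D.m) := ⟨⟨0, D.m_pos⟩⟩

theorem one_lt_p : (1 : ℝ) < D.p := by exact_mod_cast D.prime.out.one_lt

/-! ### Coordinates and the norm `M` -/

theorem abv_repr_le_M (v : D.V) (i : Fin D.m) : D.abv (D.e.repr v i) ≤ D.M v :=
  le_ciSup (f := fun i => D.abv (D.e.repr v i)) (Set.finite_range _).bddAbove i

theorem M_le {v : D.V} {C : ℝ} (h : ∀ i, D.abv (D.e.repr v i) ≤ C) : D.M v ≤ C := ciSup_le h

theorem M_nonneg (v : D.V) : 0 ≤ D.M v :=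
  (abv_nonneg _).trans (D.abv_repr_le_M v ⟨0, D.m_pos⟩)

theorem isUltraNorm_M : IsUltraNorm D.abv D.M where
  nonneg := D.M_nonneg
  eq_zero_iff v := by
    constructor
    · intro h
      rw [← D.e.forall_coord_eq_zero_iff]
      intro i
      exact ((D.F.isUltraNorm_abv D.p).eq_zero_iff _).1
        (le_antisymm (h ▸ D.abv_repr_le_M v i) (abv_nonneg _))
    · rintro rfl
      refine le_antisymm (D.M_le fun i => ?_) (D.M_nonneg 0)
      simp [abv_zero]
  smul x v := by
    rw [M, M, Real.mul_iSup_of_nonneg (abv_nonneg x)]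
    simp [abv_mul]
  add_le_max v w := by
    refine D.M_le fun i => ?_
    rw [map_add, Finsupp.add_apply]
    exact ((D.F.isUltraNorm_abv D.p).add_le_max _ _).trans
      (max_le_max (D.abv_repr_le_M v i) (D.abv_repr_le_M w i))

theorem mem_otherLattice_iff (j : Fin D.m) (v : D.V) :
    v ∈ D.otherLattice j ↔ D.e.repr v j = 0 ∧ ∀ i, D.abv (D.e.repr v i) ≤ 1 := by
  have hsum : ∀ y : Fin D.m → D.K, y j = 0 →
      ∑ i : {i : Fin D.m // i ≠ j}, y i • D.e i = ∑ i, y i • D.e i := by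
    intro y hy
    rw [Fintype.sum_eq_add_sum_subtype_ne _ j, hy, zero_smul, zero_add]
  constructor
  · rintro ⟨x, hx, rfl⟩
    -- Extending the coefficients by `0` at `j` turns the sum over the subtype into a coordinate
    -- expansion.
    let y : Fin D.m → D.K := fun i => if h : i ≠ j then x ⟨i, h⟩ else 0
    have hy : ∑ i : {i : Fin D.m // i ≠ j}, x i • D.e i = ∑ i, y i • D.e i := by
      rw [← hsum y (by simp [y])]
      refine Finset.sum_congr rfl fun i _ => ?_
      simp [y, i.2]
    have hr : ∀ i, D.e.repr (∑ i : {i : Fin D.m // i ≠ j}, x i • D.e i) i = y i := by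
      intro i
      rw [hy, D.e.repr_sum_self]
    refine ⟨by rw [hr]; simp [y], fun i => ?_⟩
    rw [hr]
    by_cases h : i ≠ j
    · simpa [y, h] using hx ⟨i, h⟩
    · rw [not_not] at h
      simp [y, h, abv_zero]
  · rintro ⟨h0, h1⟩
    refine ⟨fun i => D.e.repr v i, fun i => h1 i, ?_⟩
    rw [hsum (fun i => D.e.repr v i) h0, D.e.sum_repr]

theorem ne_of_mem_otherLattice {j : Fin D.m} {v : D.V} (hv : v ∈ D.otherLattice j) :
    D.e j - v ≠ 0 := by
  intro h
  have := ((D.mem_otherLattice_iff j v).1 hv).1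
  rw [← sub_eq_zero.1 h] at this
  simp at this

/-! ### The largest norm of a basis vector -/

theorem norm_basis_pos (i : Fin D.m) : 0 < D.N (D.e i) := D.isNorm.pos (D.e.ne_zero i)

theorem norm_basis_le (i : Fin D.m) : D.N (D.e i) ≤ D.maxBasisNorm :=
  le_ciSup (f := fun i => D.N (D.e i)) (Set.finite_range _).bddAbove i

theorem maxBasisNorm_pos : 0 < D.maxBasisNorm :=
  (D.norm_basis_pos ⟨0, D.m_pos⟩).trans_le (D.norm_basis_le _)

theorem norm_le_mul_maxBasisNorm (v : D.V) {C : ℝ} (h : ∀ i, D.abv (D.e.repr v i) ≤ C) :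
    D.N v ≤ C * D.maxBasisNorm := by
  have hC : 0 ≤ C := (abv_nonneg _).trans (h ⟨0, D.m_pos⟩)
  rw [← D.e.sum_repr v]
  refine D.isNorm.sum_le _ _ (mul_nonneg hC D.maxBasisNorm_pos.le) fun i _ => ?_
  rw [D.isNorm.smul]
  exact mul_le_mul (h i) (D.norm_basis_le i) (D.isNorm.nonneg _) hC

/-! ### The distances -/

/-- `L_j` is the image of a power of the compact parameter space of the integers, and `N (e_j - ·)`
is continuous along this parametrization, so it has a minimum. -/
theorem exists_closest (j : Fin D.m) : ∃ v₀ ∈ D.otherLattice j,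
    ∀ v ∈ D.otherLattice j, D.N (D.e j - v₀) ≤ D.N (D.e j - v) := by
  obtain ⟨X, _, _, Φ, hΦ, hcont⟩ := exists_compact_parametrization D.F D.p
  have hint : ∀ a, D.abv (Φ a) ≤ 1 := fun a => by
    have : Φ a ∈ Set.range Φ := ⟨a, rfl⟩
    rwa [hΦ] at this
  have hsurj : ∀ x, D.abv x ≤ 1 → ∃ a, Φ a = x := fun x hx => by
    have : x ∈ Set.range Φ := by rw [hΦ]; exact hx
    exact this
  obtain ⟨a₀, -⟩ := hsurj 0 (abv_zero.trans_le zero_le_one)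
  let g : ({i : Fin D.m // i ≠ j} → X) → D.V := fun a => ∑ i, Φ (a i) • D.e i
  have hg : Continuous fun a => D.N (D.e j - g a) := by
    rw [continuous_iff_continuousAt]
    intro a
    rw [ContinuousAt, Metric.tendsto_nhds]
    intro ε hε
    have hC := D.maxBasisNorm_pos
    have hev : ∀ᶠ b in nhds a, ∀ i, D.abv (Φ (b i) - Φ (a i)) < ε / 2 / D.maxBasisNorm := by
      rw [Filter.eventually_all]
      intro i
      exact (continuous_apply i).continuousAt.eventually (hcont (a i) _ (by positivity))
    filter_upwards [hev] with b hb
    rw [Real.dist_eq]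
    refine (D.isNorm.abs_sub_le_norm_sub _ _).trans_lt ?_
    have : D.e j - g b - (D.e j - g a) = -∑ i, (Φ (b i) - Φ (a i)) • D.e i := by
      simp only [g, sub_smul, Finset.sum_sub_distrib]
      abel
    rw [this, D.isNorm.map_neg]
    refine (D.isNorm.sum_le _ _ (half_pos hε).le fun i _ => ?_).trans_lt (half_lt_self hε)
    rw [D.isNorm.smul]
    calc _ ≤ ε / 2 / D.maxBasisNorm * D.maxBasisNorm :=
          mul_le_mul (hb i).le (D.norm_basis_le i) (D.isNorm.nonneg _) (by positivity)
      _ = ε / 2 := by field_simp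
  obtain ⟨a, -, ha⟩ := isCompact_univ.exists_isMinOn ⟨fun _ => a₀, Set.mem_univ _⟩ hg.continuousOn
  refine ⟨g a, ⟨fun i => Φ (a i), fun i => hint _, rfl⟩, ?_⟩
  rintro v ⟨x, hx, rfl⟩
  choose b hb using fun i => hsurj (x i) (hx i)
  have := ha (Set.mem_univ b)
  simpa [g, hb] using this

theorem normDist_eq_of_closest {j : Fin D.m} {v₀ : D.V} (h₀ : v₀ ∈ D.otherLattice j)
    (h : ∀ v ∈ D.otherLattice j, D.N (D.e j - v₀) ≤ D.N (D.e j - v)) :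
    D.N (D.e j - v₀) = normDist D.N (D.e j) (D.otherLattice j) := by
  symm
  refine IsLeast.csInf_eq ⟨⟨v₀, h₀, rfl⟩, ?_⟩
  rintro _ ⟨v, hv, rfl⟩
  exact h v hv

theorem normDist_le {j : Fin D.m} {v : D.V} (hv : v ∈ D.otherLattice j) :
    normDist D.N (D.e j) (D.otherLattice j) ≤ D.N (D.e j - v) := by
  obtain ⟨v₀, h₀, h⟩ := D.exists_closest j
  rw [← D.normDist_eq_of_closest h₀ h]
  exact h v hv

theorem normDist_pos (j : Fin D.m) : 0 < normDist D.N (D.e j) (D.otherLattice j) := by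
  obtain ⟨v₀, h₀, h⟩ := D.exists_closest j
  rw [← D.normDist_eq_of_closest h₀ h]
  exact D.isNorm.pos (D.ne_of_mem_otherLattice h₀)

theorem minBasisDist_le (j : Fin D.m) :
    D.minBasisDist ≤ normDist D.N (D.e j) (D.otherLattice j) :=
  ciInf_le (f := fun j => normDist D.N (D.e j) (D.otherLattice j))
    (Set.finite_range _).bddBelow j

theorem exists_minBasisDist_eq :
    ∃ j, normDist D.N (D.e j) (D.otherLattice j) = D.minBasisDist :=
  exists_eq_ciInf_of_finite (f := fun j => normDist D.N (D.e j) (D.otherLattice j))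

theorem minBasisDist_pos : 0 < D.minBasisDist := by
  obtain ⟨j, hj⟩ := D.exists_minBasisDist_eq
  exact hj ▸ D.normDist_pos j

theorem c₁_pos : 0 < D.c₁ := inv_pos.2 D.maxBasisNorm_pos

theorem c₂_pos : 0 < D.c₂ := inv_pos.2 D.minBasisDist_pos

theorem c₁_mul_le (v : D.V) : D.c₁ * D.N v ≤ D.M v := by
  rw [c₁, inv_mul_le_iff₀ D.maxBasisNorm_pos, mul_comm]
  exact D.norm_le_mul_maxBasisNorm v (D.abv_repr_le_M v)

/-- After division by a coordinate of largest absolute value, `v` becomes a difference `e_j - w`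
with `w` in `L_j`, whose norm is at least the distance. -/
theorem M_le_c₂_mul (v : D.V) : D.M v ≤ D.c₂ * D.N v := by
  rw [c₂, le_inv_mul_iff₀ D.minBasisDist_pos]
  obtain ⟨j, hj⟩ := exists_eq_ciSup_of_finite (f := fun i => D.abv (D.e.repr v i))
  replace hj : D.abv (D.e.repr v j) = D.M v := hj
  rcases eq_or_ne (D.e.repr v j) 0 with h0 | h0
  · rw [← hj, h0, NormedSetting.abv, abv_zero, mul_zero]
    exact D.isNorm.nonneg v
  · have hpos : 0 < D.abv (D.e.repr v j) := (D.F.isUltraNorm_abv D.p).pos h0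
    -- The `j`-th coordinate cancels; the others are quotients by the largest coordinate, hence
    -- integral.
    have hmem : D.e j - (D.e.repr v j)⁻¹ • v ∈ D.otherLattice j := by
      rw [mem_otherLattice_iff]
      refine ⟨by simp [h0], fun i => ?_⟩
      rw [map_sub, map_smul, Finsupp.sub_apply, Finsupp.smul_apply, smul_eq_mul]
      refine (abv_sub_le_max _ _).trans (max_le ?_ ?_)
      · rw [D.e.repr_self]
        rcases eq_or_ne i j with rfl | hij
        · simp [abv_one]
        · simp [Finsupp.single_eq_of_ne hij, abv_zero]
      · rw [abv_mul, abv_inv, inv_mul_le_one₀ hpos, hj]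
        exact D.abv_repr_le_M v i
    have h := (D.minBasisDist_le j).trans (D.normDist_le hmem)
    rw [sub_sub_cancel, D.isNorm.smul, abv_inv, le_inv_mul_iff₀ hpos, hj] at h
    linarith

/-! ### Lattices -/

theorem abv_dot_le (v w : D.V) : D.abv (D.dot v w) ≤ D.M v * D.M w := by
  refine abv_sum_le _ _ (mul_nonneg (D.M_nonneg v) (D.M_nonneg w)) fun i _ => ?_
  rw [abv_mul]
  exact mul_le_mul (D.abv_repr_le_M v i) (D.abv_repr_le_M w i) (abv_nonneg _) (D.M_nonneg v)

theorem dot_sum_smul_left {ι : Type*} (s : Finset ι) (x : ι → D.K) (b : ι → D.V) (w : D.V) :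
    D.dot (∑ i ∈ s, x i • b i) w = ∑ i ∈ s, x i * D.dot (b i) w := by
  simp only [dot, map_sum, map_smul, Finsupp.coe_finsetSum, Finset.sum_apply, Finsupp.smul_apply,
    smul_eq_mul, Finset.mul_sum, Finset.sum_mul, mul_assoc]
  exact Finset.sum_comm

theorem dot_comm (v w : D.V) : D.dot v w = D.dot w v :=
  Finset.sum_congr rfl fun _ _ => mul_comm _ _

theorem dot_sum_smul_right {ι : Type*} (s : Finset ι) (x : ι → D.K) (b : ι → D.V) (w : D.V) :
    D.dot w (∑ i ∈ s, x i • b i) = ∑ i ∈ s, x i * D.dot w (b i) := by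
  rw [dot_comm, dot_sum_smul_left]
  exact Finset.sum_congr rfl fun i _ => by rw [D.dot_comm w]

theorem dot_smul_left (x : D.K) (v w : D.V) : D.dot (x • v) w = x * D.dot v w := by
  simpa using D.dot_sum_smul_left {()} (fun _ => x) (fun _ => v) w

/-- An ultrametric Hadamard inequality: each Leibniz product of the Gram matrix pairs `M (B (σ i))`
with `M (B i)`, so every vector contributes twice, and the square root undoes this. -/
theorem latticeDet_le_prod_M {n : ℕ} (B : Fin n → D.V) : D.latticeDet B ≤ ∏ i, D.M (B i) := by
  have hnn : 0 ≤ ∏ i, D.M (B i) := Finset.prod_nonneg fun i _ => D.M_nonneg _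
  rw [latticeDet, Real.sqrt_le_left hnn]
  refine abv_det_le _ (sq_nonneg _) fun σ => ?_
  calc _ ≤ ∏ i, D.M (B (σ i)) * D.M (B i) :=
        Finset.prod_le_prod (fun i _ => abv_nonneg _) fun i _ => D.abv_dot_le _ _
    _ = (∏ i, D.M (B i)) ^ 2 := by
        rw [Finset.prod_mul_distrib, Equiv.prod_comp σ fun i => D.M (B i), sq]

theorem latticeDet_le_prod_norm {n : ℕ} (B : Fin n → D.V) :
    D.latticeDet B ≤ D.c₂ ^ n * ∏ i, D.N (B i) := by
  refine (D.latticeDet_le_prod_M B).trans ?_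
  calc _ ≤ ∏ i, D.c₂ * D.N (B i) :=
        Finset.prod_le_prod (fun i _ => D.M_nonneg _) fun i _ => D.M_le_c₂_mul _
    _ = _ := by rw [Finset.prod_mul_distrib, Finset.prod_const, Finset.card_fin]

/-- The Gram matrix of `B` is `U G Uᵀ` with `G` that of `α` and `U` integral, so `|det U| ≤ 1`. This
allows the determinant of the given basis to be replaced by that of the orthogonal one. -/
theorem latticeDet_le_of_mem {n : ℕ} {B α : Fin n → D.V}
    (h : ∀ i, B i ∈ latticeSpan D.abv α) : D.latticeDet B ≤ D.latticeDet α := by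
  choose U hU hB using h
  refine Real.sqrt_le_sqrt ?_
  have hmat : (Matrix.of fun i j => D.dot (B i) (B j)) =
      Matrix.of U * (Matrix.of fun i j => D.dot (α i) (α j)) * (Matrix.of U).transpose := by
    ext i j
    simp only [Matrix.of_apply, Matrix.mul_apply, Matrix.transpose_apply]
    rw [hB i, hB j, dot_sum_smul_right]
    refine Finset.sum_congr rfl fun l _ => ?_
    rw [dot_sum_smul_left, mul_comm]
  have hdet : D.abv (Matrix.of U).det ≤ 1 := abv_det_le _ zero_le_one fun σ =>
    Finset.prod_le_one (fun i _ => abv_nonneg _) fun i _ => hU _ _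
  rw [hmat, Matrix.det_mul, Matrix.det_mul, Matrix.det_transpose, NormedSetting.abv, abv_mul, abv_mul]
  rw [mul_right_comm]
  exact mul_le_of_le_one_left (abv_nonneg _) (mul_le_one₀ hdet (abv_nonneg _) hdet)

/-- By the ultrametric inequality a largest norm occurs at a generator; replacing every factor of
the Hadamard bound by it gives an `n`-th power. -/
theorem exists_isGreatest_norm {n : ℕ} (hn : 0 < n) (B : Fin n → D.V) :
    ∃ lam₁, IsGreatest (D.N '' latticeSpan D.abv B) lam₁ ∧
      D.cFirst * D.latticeDet B ^ (1 / (n : ℝ)) ≤ lam₁ := by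
  have : Nonempty (Fin n) := ⟨⟨0, hn⟩⟩
  obtain ⟨i₀, h₀⟩ := Finite.exists_max fun i => D.N (B i)
  refine ⟨D.N (B i₀), ⟨⟨B i₀, mem_latticeSpan B i₀, rfl⟩, ?_⟩, ?_⟩
  · rintro _ ⟨v, hv, rfl⟩
    exact D.isNorm.le_of_mem_latticeSpan (D.isNorm.nonneg _) h₀ hv
  · have hc := D.c₂_pos
    have hN := D.isNorm.nonneg (B i₀)
    rw [cFirst, one_div_mul_eq_div, div_le_iff₀' hc]
    have h : D.latticeDet B ≤ (D.c₂ * D.N (B i₀)) ^ n := by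
      refine (D.latticeDet_le_prod_norm B).trans ?_
      rw [mul_pow]
      refine mul_le_mul_of_nonneg_left ?_ (by positivity)
      calc _ ≤ ∏ _i : Fin n, D.N (B i₀) :=
            Finset.prod_le_prod (fun i _ => D.isNorm.nonneg _) fun i _ => h₀ i
        _ = _ := by rw [Finset.prod_const, Finset.card_fin]
    calc _ ≤ ((D.c₂ * D.N (B i₀)) ^ n) ^ (1 / (n : ℝ)) :=
          Real.rpow_le_rpow (Real.sqrt_nonneg _) h (by positivity)
      _ = _ := by rw [one_div, Real.pow_rpow_inv_natCast (by positivity) hn.ne']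

theorem cSecond_mul_le {n : ℕ} (B : Fin n → D.V) (lam : Fin n → ℝ)
    (h : IsSuccessiveMaxima D.abv D.N (latticeSpan D.abv B) lam) :
    D.cSecond n * D.latticeDet B ≤ ∏ i, lam i := by
  obtain ⟨α, hα, hlam, -⟩ := h
  have hc := D.c₂_pos
  rw [cSecond, one_div_mul_eq_div, div_le_iff₀' (by positivity)]
  simp only [hlam]
  refine (D.latticeDet_le_of_mem fun i => ?_).trans (D.latticeDet_le_prod_norm α)
  rw [← hα.span_eq]
  exact mem_latticeSpan B i

theorem cTransfer_le {n : ℕ} (hn : 0 < n) (B : Fin n → D.V) (lam mu : Fin n → ℝ)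
    (hlam : IsSuccessiveMaxima D.abv D.N (latticeSpan D.abv B) lam)
    (hmu : IsSuccessiveMaxima D.abv D.N (D.dualLattice (latticeSpan D.abv B)) mu) :
    D.cTransfer ≤ lam ⟨0, hn⟩ * mu ⟨n - 1, Nat.sub_lt hn Nat.one_pos⟩ := by
  obtain ⟨α, hα, hlam, hanti⟩ := hlam
  obtain ⟨β, hβ, hmu, -⟩ := hmu
  have hc := D.c₂_pos
  have hp := D.one_lt_p
  set l : Fin n := ⟨n - 1, Nat.sub_lt hn Nat.one_pos⟩
  have hβmem : β l ∈ D.dualLattice (latticeSpan D.abv B) := by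
    rw [hβ.span_eq]
    exact mem_latticeSpan β l
  -- If all products had absolute value below `1`, they would be at most `p⁻¹` by discreteness, and
  -- `π⁻¹ • β l` would still lie in the dual lattice.
  obtain ⟨i, hi⟩ : ∃ i, 1 ≤ D.abv (D.dot (β l) (α i)) := by
    by_contra! hlt
    have hmem : (D.F.unif D.p)⁻¹ • β l ∈ D.dualLattice (latticeSpan D.abv B) := by
      refine ⟨Submodule.smul_mem _ _ hβmem.1, fun x hx => ?_⟩
      rw [hα.span_eq] at hx
      obtain ⟨y, hy, rfl⟩ := hx
      rw [dot_sum_smul_right]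
      refine abv_sum_le _ _ zero_le_one fun i _ => ?_
      rw [dot_smul_left, abv_mul, abv_mul, abv_inv, abv_unif, inv_inv]
      refine mul_le_one₀ (hy i) (mul_nonneg (by positivity) (abv_nonneg _)) ?_
      calc _ ≤ (D.p : ℝ) * (D.p : ℝ)⁻¹ :=
            mul_le_mul_of_nonneg_left (abv_le_inv_of_lt_one (hlt i)) (by positivity)
        _ = 1 := mul_inv_cancel₀ (by positivity)
    rw [hβ.span_eq] at hmem
    obtain ⟨y, hy, hyl⟩ := hmem
    -- By linear independence the coefficient of `β l` must be `π⁻¹`, which has absolute value `p >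
    -- 1` and is not integral.
    have hcoef : Pi.single l (D.F.unif D.p)⁻¹ = y := by
      refine hβ.linearIndependent.fintypeLinearCombination_injective ?_
      simp only [Fintype.linearCombination_apply]
      rw [← hyl]
      simp [Pi.single_apply, ite_smul]
    have h1 := hy l
    rw [← hcoef, Pi.single_eq_same, NormedSetting.abv, abv_inv, abv_unif, inv_inv] at h1
    linarith
  rw [cTransfer, div_le_iff₀ (by positivity)]
  -- The index `i` is unknown, but the first successive maximum dominates them all.
  have h1 : D.N (α i) ≤ lam ⟨0, hn⟩ := by
    rw [← hlam i]
    exact hanti (Fin.mk_le_of_le_val (Nat.zero_le _))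
  calc (1 : ℝ) ≤ D.M (β l) * D.M (α i) := hi.trans (D.abv_dot_le _ _)
    _ ≤ (D.c₂ * D.N (β l)) * (D.c₂ * D.N (α i)) :=
        mul_le_mul (D.M_le_c₂_mul _) (D.M_le_c₂_mul _) (D.M_nonneg _)
          (mul_nonneg hc.le (D.isNorm.nonneg _))
    _ ≤ (D.c₂ * D.N (β l)) * (D.c₂ * lam ⟨0, hn⟩) := by
        have := D.isNorm.nonneg (β l)
        gcongr
    _ = lam ⟨0, hn⟩ * mu l * D.c₂ ^ 2 := by rw [hmu l]; ring

end NormedSetting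

/-! ### Oracle algorithms that proceed in stages -/

section StagedAlgorithm

open Encodable

variable {I Q A R : Type} [Primcodable Q]

/-- The query with code `n`. -/
def queryAt (Q : Type) [Primcodable Q] [Inhabited Q] (n : ℕ) : Q :=
  (decode (α := Q) n).getD default

theorem queryAt_encode [Inhabited Q] (q : Q) : queryAt Q (encode q) = q := by
  simp [queryAt]

theorem primrec_queryAt [Inhabited Q] : Primrec (queryAt Q) :=
  Primrec.option_getD_default.comp Primrec.decode

/-- The answers of the oracle to the first `n` queries. -/
def answerTable [Inhabited Q] (O : Q → A) (n : ℕ) : List A :=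
  (List.range n).map fun c => O (queryAt Q c)

theorem length_answerTable [Inhabited Q] (O : Q → A) (n : ℕ) :
    (answerTable O n).length = n := by
  simp [answerTable]

theorem answerTable_getElem?_encode [Inhabited Q] (O : Q → A) (n : ℕ) (q : Q) :
    (answerTable O n)[encode q]? = if encode q < n then some (O q) else none := by
  rw [answerTable, List.getElem?_map]
  split_ifs with h
  · rw [List.getElem?_range h, Option.map_some, queryAt_encode]
  · rw [List.getElem?_eq_none (by simpa using h), Option.map_none]

variable [Primcodable I] [Primcodable A] [Primcodable R]

/-- A computable decision procedure that eventually succeeds on the table of all answers of an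
oracle is an oracle algorithm. -/
theorem exists_oracleAlgorithm_of_decision [Inhabited Q] (dec : I → List A → Option R)
    (hdec : Computable₂ dec) :
    ∃ 𝒜 : OracleAlgorithm I Q A R, ∀ (O : Q → A) (i : I),
      (∃ n, (dec i (answerTable O n)).isSome) →
        ∃ n r, dec i (answerTable O n) = some r ∧ 𝒜.Outputs O i r := by
  -- The next query is the one whose code is the number of answers received, so the answers always
  -- form an initial segment of the full table.
  let next : I → List A → Q ⊕ R := fun i l =>
    Option.casesOn (dec i l) (Sum.inl (queryAt Q l.length)) fun r => Sum.inr r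
  have hnext : Computable₂ next :=
    Computable.option_casesOn hdec
      (Computable.sumInl.comp ((primrec_queryAt.to_comp).comp
        (Computable.list_length.comp Computable.snd)))
      (Computable.sumInr.comp Computable.snd).to₂
  refine ⟨⟨next, hnext⟩, fun O i h => ?_⟩
  classical
  obtain ⟨r, hr⟩ := Option.isSome_iff_exists.1 (Nat.find_spec h)
  refine ⟨Nat.find h, r, hr, answerTable O (Nat.find h), ?_, by simp [next, hr]⟩
  have key : ∀ n ≤ Nat.find h, OracleAlgorithm.Reaches ⟨next, hnext⟩ O i (answerTable O n) := by
    intro n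
    induction n with
    | zero => exact fun _ => .start
    | succ n ih =>
      intro hn
      have hnone : dec i (answerTable O n) = none :=
        Option.not_isSome_iff_eq_none.1 (Nat.find_min h hn)
      have := OracleAlgorithm.Reaches.ask (𝒜 := ⟨next, hnext⟩) _ (queryAt Q n) (ih (by omega))
        (by simp [next, hnone, length_answerTable])
      simpa [answerTable, List.range_succ] using this
  exact key _ le_rfl

/-- Equal length means that no lookup failed. This is how an algorithm recognises that its table
already answers all queries of a stage. -/
theorem List.filterMap_eq_map_of_length {α β : Type*} {g : α → Option β} {f : α → β} {l : List α}
    (hg : ∀ a b, g a = some b → b = f a) (hl : (l.filterMap g).length = l.length) :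
    l.filterMap g = l.map f := by
  induction l with
  | nil => rfl
  | cons a l ih =>
    cases h : g a with
    | none =>
      rw [List.filterMap_cons_none h, List.length_cons] at hl
      have := List.length_filterMap_le g l
      omega
    | some b =>
      rw [List.filterMap_cons_some h] at hl ⊢
      rw [List.map_cons, ih (by simpa using hl), hg a b h]

/-- A procedure that, at each stage `s`, asks the finitely many queries `qs (i, s)` and then either
halts or goes on, is an oracle algorithm. -/
theorem exists_oracleAlgorithm_of_stages [Inhabited Q] {qs : I × ℕ → List Q}
    {body : (I × ℕ) × List A → Option R} (hqs : Primrec qs) (hbody : Primrec body) :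
    ∃ 𝒜 : OracleAlgorithm I Q A R, ∀ (O : Q → A) (i : I) (P : R → Prop),
      (∀ s r, body ((i, s), (qs (i, s)).map O) = some r → P r) →
      (∃ s, (body ((i, s), (qs (i, s)).map O)).isSome) → ∃ r, 𝒜.Outputs O i r ∧ P r := by
  -- The stage is the first unpaired component of the number of answers, so each stage is revisited
  -- with arbitrarily long tables.
  let st : I × List A → I × ℕ := fun x => (x.1, x.2.length.unpair.1)
  let ans : I × List A → List A := fun x => (qs (st x)).filterMap fun q => x.2[encode q]?
  let dec : I → List A → Option R := fun i l =>
    if (ans (i, l)).length = (qs (st (i, l))).length then body (st (i, l), ans (i, l)) else none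
  have hst : Primrec st := Primrec.pair Primrec.fst
    (Primrec.fst.comp (Primrec.unpair.comp (Primrec.list_length.comp Primrec.snd)))
  have hans : Primrec ans := Primrec.listFilterMap (hqs.comp hst)
    (Primrec.list_getElem?.comp (Primrec.snd.comp Primrec.fst)
      (Primrec.encode.comp Primrec.snd)).to₂
  have hdec : Primrec₂ dec := Primrec.ite
    (Primrec.eq.comp (Primrec.list_length.comp hans) (Primrec.list_length.comp (hqs.comp hst)))
    (hbody.comp (Primrec.pair hst hans)) (Primrec.const none)
  obtain ⟨𝒜, h𝒜⟩ := exists_oracleAlgorithm_of_decision (Q := Q) dec hdec.to_comp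
  refine ⟨𝒜, fun O i P hP ⟨s, hs⟩ => ?_⟩
  have hsound : ∀ n q a, (answerTable O n)[encode q]? = some a → a = O q := by
    intro n q a h
    rw [answerTable_getElem?_encode] at h
    split_ifs at h
    exact (Option.some_inj.1 h).symm
  obtain ⟨n, r, hr, hout⟩ := h𝒜 O i (by
    -- `t` exceeds every code needed at stage `s`, and `Nat.pair s t ≥ t`, so a table of this length
    -- selects stage `s` and answers all its queries.
    let t := ((qs (i, s)).map encode).sum + 1
    refine ⟨Nat.pair s t, ?_⟩
    have h1 : st (i, answerTable O (Nat.pair s t)) = (i, s) := by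
      simp [st, length_answerTable]
    have h2 : ans (i, answerTable O (Nat.pair s t)) = (qs (i, s)).map O := by
      simp only [ans, h1]
      rw [← List.filterMap_eq_map]
      refine List.filterMap_congr fun q hq => ?_
      rw [answerTable_getElem?_encode, if_pos]
      · rfl
      · have : encode q ≤ ((qs (i, s)).map encode).sum :=
          List.single_le_sum (by simp) _ (List.mem_map_of_mem hq)
        exact (Nat.lt_succ_of_le this).trans_le (Nat.right_le_pair s t)
    simp only [dec]
    rw [if_pos (by rw [h1, h2, List.length_map]), h1, h2]
    exact hs)
  refine ⟨r, hout, ?_⟩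
  simp only [dec] at hr
  split_ifs at hr with hlen
  -- The run may halt at a stage other than `s`; there too the answers are genuine, so soundness
  -- applies.
  have hmap : ans (i, answerTable O n) = (qs (st (i, answerTable O n))).map O :=
    List.filterMap_eq_map_of_length (fun q a => hsound n q a) hlen
  rw [hmap] at hr
  exact hP _ _ hr

end StagedAlgorithm

/-! ### Primitive recursive auxiliary functions -/

section PrimrecAux

theorem Primrec.nat_pow : Primrec₂ ((· ^ ·) : ℕ → ℕ → ℕ) :=
  Primrec₂.unpaired'.1 Nat.Primrec.pow

theorem primrec_intCast : Primrec fun n : ℕ => (n : ℤ) := by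
  rw [← Primrec.encode_iff]
  exact (Primrec.nat_mul.comp (Primrec.const 2) Primrec.id).of_eq fun n => rfl

theorem primrec_neg_intCast : Primrec fun n : ℕ => -(n : ℤ) := by
  rw [← Primrec.encode_iff]
  -- The code of `-(n + 1)` is `2 * n + 1` and that of `0` is `0`; truncated subtraction makes `2 *
  -- n - 1` correct in both cases.
  refine (Primrec.nat_sub.comp (Primrec.nat_mul.comp (Primrec.const 2) Primrec.id)
    (Primrec.const 1)).of_eq fun n => ?_
  cases n <;> rfl

/-- All lists of length `n` with entries in `l`. -/
def listsOfLength {α : Type*} (l : List α) : ℕ → List (List α)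
  | 0 => [[]]
  | n + 1 => (listsOfLength l n).flatMap fun t => l.map fun a => a :: t

theorem mem_listsOfLength {α : Type*} {l : List α} {n : ℕ} {t : List α} :
    t ∈ listsOfLength l n ↔ t.length = n ∧ ∀ a ∈ t, a ∈ l := by
  induction n generalizing t with
  | zero =>
    simp only [listsOfLength, List.mem_singleton, List.length_eq_zero_iff]
    constructor
    · rintro rfl; simp
    · exact fun h => h.1
  | succ n ih =>
    cases t with
    | nil => simp [listsOfLength]
    | cons a t =>
      simp [listsOfLength, ih]
      tauto

theorem primrec_listsOfLength {α : Type} [Primcodable α] :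
    Primrec₂ (listsOfLength : List α → ℕ → List (List α)) := by
  have hstep : Primrec₂ fun (l : List α) (x : ℕ × List (List α)) =>
      x.2.flatMap fun t => l.map fun a => a :: t :=
    Primrec.list_flatMap (Primrec.snd.comp Primrec.snd)
      (Primrec.list_map (Primrec.fst.comp Primrec.fst)
        (Primrec.list_cons.comp Primrec.snd (Primrec.snd.comp Primrec.fst)).to₂).to₂
  refine (Primrec.nat_rec (f := fun _ => [[]]) (Primrec.const _) hstep).of_eq fun l n => ?_
  induction n with
  | zero => rfl
  | succ n ih => simp only [ih, listsOfLength]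

/-- The maximum of a list of natural numbers. -/
def listMax (l : List ℕ) : ℕ := l.foldr max 0

/-- The minimum of a nonempty list of natural numbers. -/
def listMin (l : List ℕ) : ℕ := l.foldr min (listMax l)

theorem primrec_listMax : Primrec listMax :=
  Primrec.list_foldr Primrec.id (Primrec.const 0)
    (Primrec.nat_max.comp (Primrec.fst.comp Primrec.snd) (Primrec.snd.comp Primrec.snd)).to₂

theorem primrec_listMin : Primrec listMin :=
  Primrec.list_foldr Primrec.id primrec_listMax
    (Primrec.nat_min.comp (Primrec.fst.comp Primrec.snd) (Primrec.snd.comp Primrec.snd)).to₂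

theorem le_listMax {l : List ℕ} {a : ℕ} (h : a ∈ l) : a ≤ listMax l := by
  induction l with
  | nil => simp at h
  | cons b l ih =>
    rcases List.mem_cons.1 h with rfl | h
    · exact le_max_left _ _
    · exact (ih h).trans (le_max_right _ _)

theorem listMax_mem {l : List ℕ} (h : l ≠ []) : listMax l ∈ l := by
  induction l with
  | nil => simp at h
  | cons b l ih =>
    change max b (listMax l) ∈ _
    rcases eq_or_ne l [] with rfl | hl
    · simp [listMax]
    · rcases max_choice b (listMax l) with h | h <;> rw [h]
      · simp
      · exact List.mem_cons_of_mem _ (ih hl)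

theorem foldr_min_le {l : List ℕ} {a : ℕ} (c : ℕ) (h : a ∈ l) : l.foldr min c ≤ a := by
  induction l with
  | nil => simp at h
  | cons b l ih =>
    rcases List.mem_cons.1 h with rfl | h
    · exact min_le_left _ _
    · exact (min_le_right _ _).trans (ih h)

theorem foldr_min_mem (l : List ℕ) (c : ℕ) : l.foldr min c ∈ c :: l := by
  induction l with
  | nil => simp
  | cons b l ih =>
    change min b (l.foldr min c) ∈ _
    rcases min_choice b (l.foldr min c) with h | h <;> rw [h]
    · simp
    · rcases List.mem_cons.1 ih with h | h <;> simp [h]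

theorem listMin_le {l : List ℕ} {a : ℕ} (h : a ∈ l) : listMin l ≤ a := foldr_min_le _ h

/-- The fold starts at `listMax l`, which is itself an entry, so the minimum is attained. -/
theorem listMin_mem {l : List ℕ} (h : l ≠ []) : listMin l ∈ l := by
  rcases List.mem_cons.1 (foldr_min_mem l (listMax l)) with h' | h'
  · rw [listMin, h']
    exact listMax_mem h
  · exact h'

end PrimrecAux

/-! ### Finite expansions -/

namespace LocalKind

variable {F : LocalKind} {p : ℕ} [hp : Fact p.Prime]

theorem unif_ne_zero : F.unif p ≠ 0 := by
  intro h
  have h' := F.abv_unif p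
  rw [h, abv_zero] at h'
  exact hp.out.ne_zero (by simpa using h'.symm)

theorem eval_nil (t : ℕ) : FinScalar.eval F p (t, []) = 0 := by simp [FinScalar.eval]

theorem eval_one (t : ℕ) : FinScalar.eval F p (t, [1]) = F.unif p ^ (-(t : ℤ)) := by
  simp [FinScalar.eval]

theorem eval_shift (t : ℕ) (ds : List ℤ) :
    FinScalar.eval F p (t, ds) = F.unif p ^ (-(t : ℤ)) * FinScalar.eval F p (0, ds) := by
  simp [FinScalar.eval]

theorem eval_cons (d : ℤ) (ds : List ℤ) :
    FinScalar.eval F p (0, d :: ds) = d + F.unif p * FinScalar.eval F p (0, ds) := by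
  simp only [FinScalar.eval, List.length_cons, Finset.sum_range_succ', List.getD_cons_succ,
    List.getD_cons_zero, Nat.cast_zero, neg_zero, zpow_zero, one_mul, pow_zero, mul_one,
    Finset.mul_sum]
  rw [add_comm]
  congr 1
  exact Finset.sum_congr rfl fun i _ => by ring

theorem eval_map_neg (ds : List ℕ) :
    FinScalar.eval F p (0, ds.map fun d : ℕ => -(d : ℤ)) =
      -FinScalar.eval F p (0, ds.map fun d : ℕ => (d : ℤ)) := by
  induction ds with
  | nil => simp [eval_nil]
  | cons d ds ih =>
    rw [List.map_cons, List.map_cons, eval_cons, eval_cons, ih]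
    push_cast
    ring

theorem abv_eval_le_one (ds : List ℤ) : F.abv p (FinScalar.eval F p (0, ds)) ≤ 1 := by
  induction ds with
  | nil => rw [eval_nil, abv_zero]; exact zero_le_one
  | cons d ds ih =>
    rw [eval_cons]
    refine ((F.isUltraNorm_abv p).add_le_max _ _).trans (max_le (abv_intCast_le_one d) ?_)
    rw [abv_mul, abv_unif]
    exact mul_le_one₀ (inv_le_one_of_one_le₀ (by exact_mod_cast hp.out.one_le)) (abv_nonneg _) ih

theorem exists_digits (s : ℕ) {x : F.Carrier p} (hx : F.abv p x ≤ 1) :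
    ∃ ds ∈ listsOfLength (List.range p) s,
      F.abv p (x - FinScalar.eval F p (0, ds.map fun d : ℕ => (d : ℤ))) ≤ (p : ℝ)⁻¹ ^ s := by
  have hp0 : (0 : ℝ) < p := by exact_mod_cast hp.out.pos
  induction s generalizing x with
  | zero => exact ⟨[], by simp [listsOfLength], by simpa [eval_nil] using hx⟩
  | succ s ih =>
    obtain ⟨d, hd, hxd⟩ := exists_digit hx
    -- Subtract the residue digit and divide by the uniformizer; the quotient is again integral.
    obtain ⟨ds, hds, h⟩ := ih (x := (F.unif p)⁻¹ * (x - d)) (by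
      rw [abv_mul, abv_inv, abv_unif, inv_inv]
      calc _ ≤ (p : ℝ) * (p : ℝ)⁻¹ := mul_le_mul_of_nonneg_left hxd hp0.le
        _ = 1 := mul_inv_cancel₀ hp0.ne')
    rw [mem_listsOfLength] at hds
    refine ⟨d :: ds, mem_listsOfLength.2 ⟨by simp [hds.1], ?_⟩, ?_⟩
    · rintro a ha
      rcases List.mem_cons.1 ha with rfl | ha
      · exact List.mem_range.2 hd
      · exact hds.2 a ha
    · have heq : x - FinScalar.eval F p (0, (d :: ds).map fun d : ℕ => (d : ℤ)) = F.unif p *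
          ((F.unif p)⁻¹ * (x - d) - FinScalar.eval F p (0, ds.map fun d : ℕ => (d : ℤ))) := by
        rw [List.map_cons, eval_cons, mul_sub, mul_inv_cancel_left₀ unif_ne_zero]
        push_cast
        ring
      rw [heq, abv_mul, abv_unif, pow_succ']
      exact mul_le_mul_of_nonneg_left h (by positivity)

end LocalKind

/-! ### Candidates for closest vectors -/

/-- The coordinate vector with the digits `z`, except that the coordinate with index `j` is `0`. -/
def digitVec (m j : ℕ) (z : List (List ℕ)) : FinVector :=
  (List.range m).map fun i => if i = j then (0, []) else (0, (z.getD i []).map fun d : ℕ => (d : ℤ))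

/-- The vector `π ^ (-t) * (e_j - v)`, where `v` is the vector `digitVec m j z`. -/
def diffVec (m j t : ℕ) (z : List (List ℕ)) : FinVector :=
  (List.range m).map fun i =>
    if i = j then (t, [1]) else (t, (z.getD i []).map fun d : ℕ => -(d : ℤ))

/-- All arrays of `m` times `s` digits. -/
def digitTables (p m s : ℕ) : List (List (List ℕ)) :=
  listsOfLength (listsOfLength (List.range p) s) m

/-- The differences `e_j - v` for all `j` and all `v` with `s` digits, and the vectors `e_j`. -/
def candidates (p m s : ℕ) : List FinVector :=
  (List.range m).flatMap fun j => ([] :: digitTables p m s).map fun z => diffVec m j 0 z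

theorem primrec_digitVec :
    Primrec fun x : ℕ × ℕ × List (List ℕ) => digitVec x.1 x.2.1 x.2.2 := by
  have hz : Primrec fun y : (ℕ × ℕ × List (List ℕ)) × ℕ => y.1.2.2.getD y.2 [] :=
    (Primrec.list_getD []).comp (Primrec.snd.comp (Primrec.snd.comp Primrec.fst)) Primrec.snd
  have hmap : Primrec fun y : (ℕ × ℕ × List (List ℕ)) × ℕ =>
      (y.1.2.2.getD y.2 []).map fun d : ℕ => (d : ℤ) :=
    Primrec.list_map hz (primrec_intCast.comp Primrec.snd).to₂
  have hentry : Primrec₂ fun (x : ℕ × ℕ × List (List ℕ)) (i : ℕ) =>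
      if i = x.2.1 then ((0, []) : FinScalar)
      else (0, (x.2.2.getD i []).map fun d : ℕ => (d : ℤ)) :=
    Primrec.ite
      (Primrec.eq.comp Primrec.snd (Primrec.fst.comp (Primrec.snd.comp Primrec.fst)))
      (Primrec.const _) (Primrec.pair (Primrec.const 0) hmap)
  exact Primrec.list_map (Primrec.list_range.comp Primrec.fst) hentry

theorem primrec_diffVec :
    Primrec fun x : ℕ × ℕ × ℕ × List (List ℕ) => diffVec x.1 x.2.1 x.2.2.1 x.2.2.2 := by
  have ht : Primrec fun y : (ℕ × ℕ × ℕ × List (List ℕ)) × ℕ => y.1.2.2.1 :=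
    Primrec.fst.comp (Primrec.snd.comp (Primrec.snd.comp Primrec.fst))
  have hz : Primrec fun y : (ℕ × ℕ × ℕ × List (List ℕ)) × ℕ => y.1.2.2.2.getD y.2 [] :=
    (Primrec.list_getD []).comp
      (Primrec.snd.comp (Primrec.snd.comp (Primrec.snd.comp Primrec.fst))) Primrec.snd
  have hmap : Primrec fun y : (ℕ × ℕ × ℕ × List (List ℕ)) × ℕ =>
      (y.1.2.2.2.getD y.2 []).map fun d : ℕ => -(d : ℤ) :=
    Primrec.list_map hz (primrec_neg_intCast.comp Primrec.snd).to₂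
  have hentry : Primrec₂ fun (x : ℕ × ℕ × ℕ × List (List ℕ)) (i : ℕ) =>
      if i = x.2.1 then ((x.2.2.1, [1]) : FinScalar)
      else (x.2.2.1, (x.2.2.2.getD i []).map fun d : ℕ => -(d : ℤ)) :=
    Primrec.ite
      (Primrec.eq.comp Primrec.snd (Primrec.fst.comp (Primrec.snd.comp Primrec.fst)))
      (Primrec.pair ht (Primrec.const _)) (Primrec.pair ht hmap)
  exact Primrec.list_map (Primrec.list_range.comp Primrec.fst) hentry

theorem primrec_digitTables :
    Primrec fun x : ℕ × ℕ × ℕ => digitTables x.1 x.2.1 x.2.2 :=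
  primrec_listsOfLength.comp
    (primrec_listsOfLength.comp (Primrec.list_range.comp Primrec.fst)
      (Primrec.snd.comp Primrec.snd)) (Primrec.fst.comp Primrec.snd)

theorem primrec_candidates :
    Primrec fun x : ℕ × ℕ × ℕ => candidates x.1 x.2.1 x.2.2 := by
  have hdiff : Primrec₂ fun (y : (ℕ × ℕ × ℕ) × ℕ) (z : List (List ℕ)) =>
      diffVec y.1.2.1 y.2 0 z :=
    primrec_diffVec.comp (Primrec.pair
      (Primrec.fst.comp (Primrec.snd.comp (Primrec.fst.comp Primrec.fst)))
      (Primrec.pair (Primrec.snd.comp Primrec.fst) (Primrec.pair (Primrec.const 0) Primrec.snd)))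
  have hmap : Primrec₂ fun (x : ℕ × ℕ × ℕ) (j : ℕ) =>
      ([] :: digitTables x.1 x.2.1 x.2.2).map fun z => diffVec x.2.1 j 0 z :=
    Primrec.list_map (Primrec.list_cons.comp (Primrec.const [])
      (primrec_digitTables.comp Primrec.fst)) hdiff
  exact Primrec.list_flatMap (Primrec.list_range.comp (Primrec.fst.comp Primrec.snd)) hmap

namespace NormedSetting

open LocalKind

variable (D : NormedSetting.{u})

theorem repr_vec (x : FinVector) (i : Fin D.m) :
    D.e.repr (D.vec x) i = FinScalar.eval D.F D.p (x.getD i (0, [])) := by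
  rw [vec, D.e.repr_sum_self]

theorem repr_vec_map_range (f : ℕ → FinScalar) (i : Fin D.m) :
    D.e.repr (D.vec ((List.range D.m).map f)) i = FinScalar.eval D.F D.p (f i) := by
  rw [repr_vec, List.getD_eq_getElem _ _ (by simp)]
  simp

theorem repr_digitVec (j i : Fin D.m) (z : List (List ℕ)) :
    D.e.repr (D.vec (digitVec D.m j z)) i =
      if i = j then 0 else
        FinScalar.eval D.F D.p (0, (z.getD i []).map fun d : ℕ => (d : ℤ)) := by
  rw [digitVec, repr_vec_map_range]
  simp only [Fin.val_inj]
  split_ifs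
  · exact eval_nil 0
  · rfl

theorem vec_digitVec_mem (j : Fin D.m) (z : List (List ℕ)) :
    D.vec (digitVec D.m j z) ∈ D.otherLattice j := by
  rw [mem_otherLattice_iff]
  refine ⟨by simp [repr_digitVec], fun i => ?_⟩
  rw [repr_digitVec]
  split_ifs
  · exact abv_zero.trans_le zero_le_one
  · exact abv_eval_le_one _

theorem vec_diffVec (j : Fin D.m) (t : ℕ) (z : List (List ℕ)) :
    D.vec (diffVec D.m j t z) =
      D.F.unif D.p ^ (-(t : ℤ)) • (D.e j - D.vec (digitVec D.m j z)) := by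
  refine D.e.ext_elem fun i => ?_
  rw [diffVec, repr_vec_map_range, map_smul, map_sub, Finsupp.smul_apply, Finsupp.sub_apply,
    repr_digitVec, D.e.repr_self, smul_eq_mul]
  simp only [Fin.val_inj]
  split_ifs with h
  · rw [h, eval_one, Finsupp.single_eq_same, sub_zero, mul_one]
  · rw [eval_shift, eval_map_neg, Finsupp.single_eq_of_ne h, zero_sub]

/-- The shift `t` lets a comparison oracle test inequalities with a factor `p ^ t`. -/
theorem norm_diffVec (j : Fin D.m) (t : ℕ) (z : List (List ℕ)) :
    D.N (D.vec (diffVec D.m j t z)) =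
      (D.p : ℝ) ^ t * D.N (D.e j - D.vec (digitVec D.m j z)) := by
  rw [vec_diffVec, D.isNorm.smul, zpow_neg, zpow_natCast, abv_inv, abv_pow, abv_unif, inv_pow,
    inv_inv]

theorem vec_diffVec_zero (j : Fin D.m) (z : List (List ℕ)) :
    D.vec (diffVec D.m j 0 z) = D.e j - D.vec (digitVec D.m j z) := by
  rw [vec_diffVec, Nat.cast_zero, neg_zero, zpow_zero, one_smul]

theorem vec_diffVec_nil (j : Fin D.m) : D.vec (diffVec D.m j 0 []) = D.e j := by
  have : D.vec (digitVec D.m j []) = 0 := by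
    refine D.e.ext_elem fun i => ?_
    rw [repr_digitVec]
    simp [eval_nil]
  rw [vec_diffVec_zero, this, sub_zero]

theorem exists_digitTable (s : ℕ) {j : Fin D.m} {v : D.V} (hv : v ∈ D.otherLattice j) :
    ∃ z ∈ digitTables D.p D.m s,
      D.N (v - D.vec (digitVec D.m j z)) ≤ (D.p : ℝ)⁻¹ ^ s * D.maxBasisNorm := by
  rw [mem_otherLattice_iff] at hv
  choose ds hds h using fun i => exists_digits s (hv.2 i)
  refine ⟨List.ofFn ds, mem_listsOfLength.2 ⟨List.length_ofFn, ?_⟩, ?_⟩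
  · intro a ha
    obtain ⟨i, rfl⟩ := (List.mem_ofFn' _ _).1 ha
    exact hds i
  · refine D.norm_le_mul_maxBasisNorm _ fun i => ?_
    rw [map_sub, Finsupp.sub_apply, repr_digitVec]
    split_ifs with hij
    · rw [hij, hv.1, sub_zero]
      exact abv_zero.trans_le (by positivity)
    · rw [List.getD_eq_getElem _ _ (by simp)]
      simpa using h i

theorem exists_eq_sub_of_mem_candidates {s : ℕ} {x : FinVector}
    (hx : x ∈ candidates D.p D.m s) : ∃ j, ∃ v ∈ D.otherLattice j, D.vec x = D.e j - v := by
  simp only [candidates, List.mem_flatMap, List.mem_range, List.mem_map] at hx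
  obtain ⟨j, hj, z, -, rfl⟩ := hx
  exact ⟨⟨j, hj⟩, _, D.vec_digitVec_mem ⟨j, hj⟩ z, D.vec_diffVec_zero ⟨j, hj⟩ z⟩

theorem mem_candidates {s : ℕ} (j : Fin D.m) {z : List (List ℕ)}
    (hz : z = [] ∨ z ∈ digitTables D.p D.m s) :
    diffVec D.m j 0 z ∈ candidates D.p D.m s := by
  simp only [candidates, List.mem_flatMap, List.mem_range, List.mem_map]
  exact ⟨j, j.2, z, by simpa using hz, rfl⟩

theorem norm_le_of_mem_candidates {s : ℕ} {x : FinVector} (hx : x ∈ candidates D.p D.m s) :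
    D.N (D.vec x) ≤ D.maxBasisNorm := by
  obtain ⟨j, v, hv, hxv⟩ := D.exists_eq_sub_of_mem_candidates hx
  rw [hxv]
  refine (D.isNorm.sub_le_max _ _).trans (max_le (D.norm_basis_le j) ?_)
  simpa using D.norm_le_mul_maxBasisNorm v ((D.mem_otherLattice_iff j v).1 hv).2

theorem le_norm_of_mem_candidates {s : ℕ} {x : FinVector} (hx : x ∈ candidates D.p D.m s) :
    D.minBasisDist ≤ D.N (D.vec x) := by
  obtain ⟨j, v, hv, hxv⟩ := D.exists_eq_sub_of_mem_candidates hx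
  rw [hxv]
  exact (D.minBasisDist_le j).trans (D.normDist_le hv)

/-- The empty table stands for `v = 0`, so the basis vectors themselves are candidates. -/
theorem exists_mem_candidates_norm_eq (s : ℕ) :
    ∃ x ∈ candidates D.p D.m s, D.N (D.vec x) = D.maxBasisNorm := by
  obtain ⟨j, hj⟩ := exists_eq_ciSup_of_finite (f := fun i => D.N (D.e i))
  exact ⟨_, D.mem_candidates j (.inl rfl), by rw [vec_diffVec_nil]; exact hj⟩

theorem exists_mem_candidates_norm_le (s : ℕ) : ∃ x ∈ candidates D.p D.m s,
    D.N (D.vec x) ≤ D.minBasisDist + (D.p : ℝ)⁻¹ ^ s * D.maxBasisNorm := by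
  obtain ⟨j, hj⟩ := D.exists_minBasisDist_eq
  obtain ⟨v₀, h₀, h⟩ := D.exists_closest j
  obtain ⟨z, hz, hzN⟩ := D.exists_digitTable s h₀
  refine ⟨_, D.mem_candidates j (.inr hz), ?_⟩
  rw [vec_diffVec_zero, ← sub_add_sub_cancel _ v₀, ← hj, ← D.normDist_eq_of_closest h₀ h]
  exact (D.isNorm.add_le_max _ _).trans
    ((max_le_add_of_nonneg (D.isNorm.nonneg _) (D.isNorm.nonneg _)).trans
      (add_le_add_right hzN _))

/-! ### Estimates of the constants -/

/-- From approximations of precision `s` to the norms of the candidates one finds an approximation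
to `2 ^ s * f` and a bound for the error, which does not grow with `s`. -/
def HasStagedEstimate (f : NormedSetting.{u} → ℝ) : Prop :=
  ∃ est : ℕ × List ℕ → ℕ × ℕ, Primrec est ∧
    ∀ (D : NormedSetting.{u}) (O : FinVector × ℕ → ℕ), D.IsNormOracle O → ∃ K : ℝ, ∀ s,
      |((est (s, (candidates D.p D.m s).map fun x => O (x, s))).1 : ℝ) - 2 ^ s * f D| ≤
        (est (s, (candidates D.p D.m s).map fun x => O (x, s))).2 ∧
      ((est (s, (candidates D.p D.m s).map fun x => O (x, s))).2 : ℝ) ≤ K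

variable {D}

theorem IsNormOracle.abs_sub_le {O : FinVector × ℕ → ℕ} (hO : D.IsNormOracle O) (x : FinVector)
    (s : ℕ) : |(O (x, s) : ℝ) - 2 ^ s * D.N (D.vec x)| ≤ 1 := by
  have h := hO x s
  have h2 : (0 : ℝ) < 2 ^ s := by positivity
  rw [IsDyadicApprox, le_div_iff₀ h2, ← abs_of_pos h2, ← abs_mul, abs_of_pos h2, sub_mul,
    div_mul_cancel₀ _ h2.ne', mul_comm (D.N _)] at h
  exact h

/-- The largest candidate norm is exactly `maxBasisNorm`, so only the oracle error `1` remains. -/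
theorem IsNormOracle.abs_listMax_sub_le {O : FinVector × ℕ → ℕ} (hO : D.IsNormOracle O) (s : ℕ) :
    |(listMax ((candidates D.p D.m s).map fun x => O (x, s)) : ℝ) - 2 ^ s * D.maxBasisNorm|
      ≤ 1 := by
  obtain ⟨x₀, hx₀, h₀⟩ := D.exists_mem_candidates_norm_eq s
  have hmem := List.mem_map_of_mem (f := fun x => O (x, s)) hx₀
  obtain ⟨x, hx, hxmax⟩ := List.mem_map.1 (listMax_mem (List.ne_nil_of_mem hmem))
  have h1 : (O (x₀, s) : ℝ) ≤ listMax ((candidates D.p D.m s).map fun x => O (x, s)) := by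
    exact_mod_cast le_listMax hmem
  have h2 := abs_le.1 (hO.abs_sub_le x₀ s)
  have h3 := abs_le.1 (hO.abs_sub_le x s)
  have h4 : (2 : ℝ) ^ s * D.N (D.vec x) ≤ 2 ^ s * D.maxBasisNorm :=
    mul_le_mul_of_nonneg_left (D.norm_le_of_mem_candidates hx) (by positivity)
  rw [h₀] at h2
  rw [abs_le]
  refine ⟨by linarith, ?_⟩
  rw [← hxmax]
  linarith

theorem hasStagedEstimate_maxBasisNorm :
    HasStagedEstimate.{u} fun D => D.maxBasisNorm :=
  ⟨fun x => (listMax x.2, 1), Primrec.pair (primrec_listMax.comp Primrec.snd) (Primrec.const 1),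
    fun _ _ hO => ⟨1, fun s => ⟨by simpa using hO.abs_listMax_sub_le s, by simp⟩⟩⟩

/-- In units of `2 ^ (-s)` the oracle costs `1` and truncation at most `maxBasisNorm`, because `2 ^
s * p ^ (-s) ≤ 1`. The latter is at most `listMax / 2 ^ s + 1`, which explains the computed error;
it never exceeds `maxBasisNorm + 3`. -/
theorem hasStagedEstimate_minBasisDist :
    HasStagedEstimate.{u} fun D => D.minBasisDist := by
  refine ⟨fun x => (listMin x.2, listMax x.2 / 2 ^ x.1 + 2), Primrec.pair
    (primrec_listMin.comp Primrec.snd) (Primrec.nat_add.comp (Primrec.nat_div.comp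
      (primrec_listMax.comp Primrec.snd) (Primrec.nat_pow.comp (Primrec.const 2) Primrec.fst))
      (Primrec.const 2)), fun D O hO => ⟨D.maxBasisNorm + 3, fun s => ?_⟩⟩
  set l := (candidates D.p D.m s).map fun x => O (x, s) with hl
  have h2 : (0 : ℝ) < 2 ^ s := by positivity
  have hmax := abs_le.1 (hO.abs_listMax_sub_le s)
  rw [← hl] at hmax
  have hC : D.maxBasisNorm ≤ (listMax l / 2 ^ s + 1 : ℕ) := by
    have h : listMax l + 1 ≤ 2 ^ s * (listMax l / 2 ^ s + 1) :=
      Nat.lt_mul_div_succ _ (by positivity)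
    have h' : (listMax l : ℝ) + 1 ≤ 2 ^ s * (listMax l / 2 ^ s + 1 : ℕ) := by exact_mod_cast h
    refine le_of_mul_le_mul_left ?_ h2
    linarith
  have hK : ((listMax l / 2 ^ s : ℕ) : ℝ) ≤ D.maxBasisNorm + 1 := by
    have h : ((listMax l / 2 ^ s : ℕ) : ℝ) ≤ listMax l / 2 ^ s := by
      simpa using Nat.cast_div_le (m := listMax l) (n := 2 ^ s) (α := ℝ)
    refine h.trans ((div_le_iff₀ h2).2 ?_)
    have : (1 : ℝ) ≤ 2 ^ s := one_le_pow₀ one_le_two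
    nlinarith
  obtain ⟨x₀, hx₀, h₀⟩ := D.exists_mem_candidates_norm_le s
  have hmem := List.mem_map_of_mem (f := fun x => O (x, s)) hx₀
  rw [← hl] at hmem
  obtain ⟨x, hx, hxmin⟩ := List.mem_map.1 (listMin_mem (List.ne_nil_of_mem hmem))
  have h3 := abs_le.1 (hO.abs_sub_le x s)
  have h4 := abs_le.1 (hO.abs_sub_le x₀ s)
  have h5 : (listMin l : ℝ) ≤ O (x₀, s) := by exact_mod_cast listMin_le hmem
  have h6 : (2 : ℝ) ^ s * D.minBasisDist ≤ 2 ^ s * D.N (D.vec x) :=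
    mul_le_mul_of_nonneg_left (D.le_norm_of_mem_candidates hx) h2.le
  have h7 : (2 : ℝ) ^ s * D.N (D.vec x₀) ≤ 2 ^ s * D.minBasisDist + D.maxBasisNorm := by
    have hp : (2 : ℝ) ^ s * (D.p : ℝ)⁻¹ ^ s ≤ 1 := by
      rw [← mul_pow]
      have hp2 : (2 : ℝ) ≤ D.p := by exact_mod_cast D.prime.out.two_le
      have hp0 : (0 : ℝ) < D.p := by linarith
      refine pow_le_one₀ (by positivity) ?_
      rwa [← div_eq_mul_inv, div_le_one hp0]
    calc (2 : ℝ) ^ s * D.N (D.vec x₀)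
        ≤ 2 ^ s * (D.minBasisDist + (D.p : ℝ)⁻¹ ^ s * D.maxBasisNorm) :=
          mul_le_mul_of_nonneg_left h₀ h2.le
      _ = 2 ^ s * D.minBasisDist + (2 ^ s * (D.p : ℝ)⁻¹ ^ s) * D.maxBasisNorm := by ring
      _ ≤ _ := by
          have := mul_le_mul_of_nonneg_right hp D.maxBasisNorm_pos.le
          linarith
  push_cast at hC ⊢
  rw [hxmin] at h3
  refine ⟨abs_le.2 ⟨?_, ?_⟩, ?_⟩
  · have : (0 : ℝ) ≤ ((listMax l / 2 ^ s : ℕ) : ℝ) := Nat.cast_nonneg _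
    linarith
  · linarith
  · linarith

end NormedSetting

/-! ### Rounding -/

/-- Given bounds `u / v ≤ x ≤ u' / v'`, a dyadic approximation to `x` of precision `r`, if the
bounds are good enough to find one. -/
def roundBounds (r : ℕ) (b : (ℕ × ℕ) × (ℕ × ℕ)) : Option ℕ :=
  if 2 ^ r * b.2.1 ≤ (2 ^ r * b.1.1 / b.1.2 + 2) * b.2.2 ∧ 0 < b.2.2 then
    some (2 ^ r * b.1.1 / b.1.2 + 1) else none

theorem primrec_roundBounds : Primrec₂ roundBounds := by
  have hpow : Primrec fun x : ℕ × (ℕ × ℕ) × (ℕ × ℕ) => 2 ^ x.1 :=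
    Primrec.nat_pow.comp (Primrec.const 2) Primrec.fst
  have hdiv : Primrec fun x : ℕ × (ℕ × ℕ) × (ℕ × ℕ) => 2 ^ x.1 * x.2.1.1 / x.2.1.2 :=
    Primrec.nat_div.comp
      (Primrec.nat_mul.comp hpow (Primrec.fst.comp (Primrec.fst.comp Primrec.snd)))
      (Primrec.snd.comp (Primrec.fst.comp Primrec.snd))
  have hv : Primrec fun x : ℕ × (ℕ × ℕ) × (ℕ × ℕ) => x.2.2.2 :=
    Primrec.snd.comp (Primrec.snd.comp Primrec.snd)
  exact Primrec.ite
    (PrimrecPred.and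
      (Primrec.nat_le.comp
        (Primrec.nat_mul.comp hpow (Primrec.fst.comp (Primrec.snd.comp Primrec.snd)))
        (Primrec.nat_mul.comp (Primrec.nat_add.comp hdiv (Primrec.const 2)) hv))
      (Primrec.nat_lt.comp (Primrec.const 0) hv))
    (Primrec.option_some.comp (Primrec.nat_add.comp hdiv (Primrec.const 1))) (Primrec.const none)

/-- With `q` the floor of `2 ^ r * u / v`, the bounds and the test give `q ≤ 2 ^ r * x ≤ q + 2`, so
the midpoint `q + 1` is within `1`. -/
theorem isDyadicApprox_of_roundBounds {r a : ℕ} {b : (ℕ × ℕ) × (ℕ × ℕ)} {x : ℝ}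
    (h : roundBounds r b = some a) (hv : 0 < b.1.2) (hlo : (b.1.1 : ℝ) ≤ x * b.1.2)
    (hhi : x * b.2.2 ≤ b.2.1) : IsDyadicApprox x r a := by
  rw [roundBounds] at h
  split_ifs at h with hc
  rw [Option.some_inj] at h
  have h2 : (0 : ℝ) < 2 ^ r := by positivity
  have hv' : (0 : ℝ) < b.1.2 := by exact_mod_cast hv
  have hw : (0 : ℝ) < b.2.2 := by exact_mod_cast hc.2
  have hfloor : ((2 ^ r * b.1.1 / b.1.2 : ℕ) : ℝ) ≤ 2 ^ r * x := by
    refine Nat.cast_div_le.trans ?_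
    rw [div_le_iff₀ hv']
    push_cast
    rw [mul_assoc]
    exact mul_le_mul_of_nonneg_left hlo h2.le
  have hceil : 2 ^ r * x ≤ ((2 ^ r * b.1.1 / b.1.2 : ℕ) : ℝ) + 2 := by
    refine le_of_mul_le_mul_right ?_ hw
    rw [mul_assoc]
    refine (mul_le_mul_of_nonneg_left hhi h2.le).trans ?_
    exact_mod_cast hc.1
  rw [IsDyadicApprox, ← h, le_div_iff₀ h2, ← abs_of_pos h2, ← abs_mul, abs_of_pos h2, sub_mul,
    div_mul_cancel₀ _ h2.ne', abs_le]
  rw [Nat.cast_add, Nat.cast_one]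
  constructor <;> linarith

/-- A gap of `2 ^ (-r)` adds `1` after scaling and the floor another `1`, which the window of width
`2` absorbs. -/
theorem isSome_roundBounds {r : ℕ} {b : (ℕ × ℕ) × (ℕ × ℕ)} (hv : 0 < b.1.2) (hw : 0 < b.2.2)
    (h : (b.2.1 : ℝ) / b.2.2 - b.1.1 / b.1.2 ≤ 1 / 2 ^ r) : (roundBounds r b).isSome := by
  rw [roundBounds, if_pos]
  · rfl
  refine ⟨?_, hw⟩
  have h2 : (0 : ℝ) < 2 ^ r := by positivity
  have hv' : (0 : ℝ) < b.1.2 := by exact_mod_cast hv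
  have hw' : (0 : ℝ) < b.2.2 := by exact_mod_cast hw
  have hfloor : 2 ^ r * ((b.1.1 : ℝ) / b.1.2) ≤ ((2 ^ r * b.1.1 / b.1.2 : ℕ) : ℝ) + 1 := by
    have : 2 ^ r * b.1.1 < b.1.2 * (2 ^ r * b.1.1 / b.1.2 + 1) := Nat.lt_mul_div_succ _ hv
    rw [← mul_div_assoc, div_le_iff₀' hv']
    exact_mod_cast this.le
  have hle : 2 ^ r * ((b.2.1 : ℝ) / b.2.2) ≤ ((2 ^ r * b.1.1 / b.1.2 : ℕ) : ℝ) + 2 := by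
    have := mul_le_mul_of_nonneg_left h h2.le
    rw [mul_sub, mul_one_div_cancel h2.ne'] at this
    linarith
  rw [← mul_div_assoc, div_le_iff₀ hw'] at hle
  exact_mod_cast hle

/-! ### Computability from the norm -/

namespace NormedSetting

/-- A function of an estimated constant is computable if it has primitive recursive bounds, which
become sharp as the precision of the estimate grows. -/
theorem HasStagedEstimate.computableFromNorm {f : NormedSetting.{u} → ℝ}
    (hf : HasStagedEstimate f) (hpos : ∀ D, 0 < f D) (φ : ℝ → ℝ)
    {bd : ℕ × ℕ × ℕ → (ℕ × ℕ) × (ℕ × ℕ)} (hbd : Primrec bd)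
    (hsound : ∀ s B E : ℕ, ∀ x : ℝ, 0 < x → |(B : ℝ) - 2 ^ s * x| ≤ E →
      0 < (bd (s, B, E)).1.2 ∧ ((bd (s, B, E)).1.1 : ℝ) ≤ φ x * (bd (s, B, E)).1.2 ∧
        φ x * (bd (s, B, E)).2.2 ≤ (bd (s, B, E)).2.1)
    (hlim : ∀ x K ε : ℝ, 0 < x → 0 < ε → ∃ s, ∀ B E : ℕ,
      |(B : ℝ) - 2 ^ s * x| ≤ (E : ℝ) → (E : ℝ) ≤ K →
      0 < (bd (s, B, E)).2.2 ∧ ((bd (s, B, E)).2.1 : ℝ) / (bd (s, B, E)).2.2 -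
        (bd (s, B, E)).1.1 / (bd (s, B, E)).1.2 ≤ ε) :
    ComputableFromNorm.{u} fun D => φ (f D) := by
  obtain ⟨est, hest, h⟩ := hf
  -- Stage `s` asks for the norms of all candidates with `s` digits to precision `s`.
  let qs : (ℕ × ℕ × ℕ) × ℕ → List (FinVector × ℕ) := fun x =>
    (candidates x.1.1 x.1.2.1 x.2).map fun v => (v, x.2)
  let body : ((ℕ × ℕ × ℕ) × ℕ) × List ℕ → Option ℕ := fun y =>
    roundBounds y.1.1.2.2 (bd (y.1.2, est (y.1.2, y.2)))
  have hqs : Primrec qs := by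
    have hcand : Primrec fun x : (ℕ × ℕ × ℕ) × ℕ => candidates x.1.1 x.1.2.1 x.2 :=
      primrec_candidates.comp (Primrec.pair (Primrec.fst.comp Primrec.fst)
        (Primrec.pair (Primrec.fst.comp (Primrec.snd.comp Primrec.fst)) Primrec.snd))
    exact Primrec.list_map hcand
      (Primrec.pair Primrec.snd (Primrec.snd.comp Primrec.fst)).to₂
  have hbody : Primrec body := by
    have hs : Primrec fun y : ((ℕ × ℕ × ℕ) × ℕ) × List ℕ => y.1.2 :=
      Primrec.snd.comp Primrec.fst
    exact primrec_roundBounds.comp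
      (Primrec.snd.comp (Primrec.snd.comp (Primrec.fst.comp Primrec.fst)))
      (hbd.comp (Primrec.pair hs (hest.comp (Primrec.pair hs Primrec.snd))))
  obtain ⟨𝒜, h𝒜⟩ := exists_oracleAlgorithm_of_stages hqs hbody
  refine ⟨𝒜, fun D O hO r => ?_⟩
  obtain ⟨K, hK⟩ := h D O hO
  have hmap : ∀ s, (qs ((D.p, D.m, r), s)).map O =
      (candidates D.p D.m s).map fun x => O (x, s) := fun s => by
    simp [qs, Function.comp_def]
  refine h𝒜 O (D.p, D.m, r) (IsDyadicApprox (φ (f D)) r) (fun s a ha => ?_) ?_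
  · rw [hmap] at ha
    obtain ⟨h1, h2, h3⟩ := hsound s _ _ (f D) (hpos D) (hK s).1
    exact isDyadicApprox_of_roundBounds ha h1 h2 h3
  · obtain ⟨s, hs⟩ := hlim (f D) K (1 / 2 ^ r) (hpos D) (by positivity)
    refine ⟨s, ?_⟩
    rw [hmap]
    obtain ⟨h1, h2⟩ := hs _ _ (hK s).1 (hK s).2
    exact isSome_roundBounds (hsound s _ _ (f D) (hpos D) (hK s).1).1 h1 h2

/-- If `E > B`, truncated subtraction gives the lower bound `0`, which is valid as `x` is positive.
-/
theorem bounds_of_abs_sub_le {s B E : ℕ} {x : ℝ} (hx : 0 < x) (h : |(B : ℝ) - 2 ^ s * x| ≤ E) :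
    2 ^ s * x ≤ (B + E : ℕ) ∧ ((B - E : ℕ) : ℝ) ≤ 2 ^ s * x := by
  have h' := abs_le.1 h
  constructor
  · push_cast; linarith
  · rcases le_total E B with hEB | hEB
    · rw [Nat.cast_sub hEB]; linarith
    · rw [Nat.sub_eq_zero_of_le hEB, Nat.cast_zero]; positivity

theorem bounds_div_of_abs_sub_le {s B E : ℕ} {x K : ℝ} (h : |(B : ℝ) - 2 ^ s * x| ≤ E)
    (hE : E ≤ K) :
    x - 2 * K / 2 ^ s ≤ ((B - E : ℕ) : ℝ) / 2 ^ s ∧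
      ((B + E : ℕ) : ℝ) / 2 ^ s ≤ x + 2 * K / 2 ^ s := by
  have h' := abs_le.1 h
  have h2 : (0 : ℝ) < 2 ^ s := by positivity
  have hsub : (B : ℝ) ≤ (B - E : ℕ) + E := by
    have : B ≤ B - E + E := by omega
    exact_mod_cast this
  have hx : x = 2 ^ s * x / 2 ^ s := by field_simp
  constructor
  · rw [hx, ← sub_div]
    refine div_le_div_of_nonneg_right ?_ h2.le
    linarith
  · rw [hx, ← add_div]
    refine div_le_div_of_nonneg_right ?_ h2.le
    push_cast
    linarith

theorem tendsto_two_mul_div_two_pow (K : ℝ) :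
    Filter.Tendsto (fun s : ℕ => 2 * K / 2 ^ s) Filter.atTop (nhds 0) := by
  have h : Filter.Tendsto (fun s : ℕ => 2 * K * (1 / 2 : ℝ) ^ s) Filter.atTop (nhds (2 * K * 0)) :=
    (tendsto_pow_atTop_nhds_zero_of_lt_one (by norm_num) (by norm_num)).const_mul _
  rw [mul_zero] at h
  refine h.congr fun s => ?_
  rw [one_div, inv_pow, div_eq_mul_inv]

theorem HasStagedEstimate.computableFromNorm_inv {f : NormedSetting.{u} → ℝ}
    (hf : HasStagedEstimate f) (hpos : ∀ D, 0 < f D) :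
    ComputableFromNorm.{u} fun D => (f D)⁻¹ := by
  have hB : Primrec fun x : ℕ × ℕ × ℕ => x.2.1 := Primrec.fst.comp Primrec.snd
  have hE : Primrec fun x : ℕ × ℕ × ℕ => x.2.2 := Primrec.snd.comp Primrec.snd
  have hp : Primrec fun x : ℕ × ℕ × ℕ => 2 ^ x.1 :=
    Primrec.nat_pow.comp (Primrec.const 2) Primrec.fst
  refine hf.computableFromNorm hpos (fun x => x⁻¹)
    -- The bounds are `2 ^ s / (B + E)` and `2 ^ s / (B - E)`. At early stages `B - E` may be `0`;
    -- then the upper inequality is trivial and `roundBounds` rejects the stage.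
    (bd := fun x => ((2 ^ x.1, x.2.1 + x.2.2), (2 ^ x.1, x.2.1 - x.2.2)))
    (Primrec.pair (Primrec.pair hp (Primrec.nat_add.comp hB hE))
      (Primrec.pair hp (Primrec.nat_sub.comp hB hE))) ?_ ?_
  · intro s B E x hx h
    obtain ⟨h1, h2⟩ := bounds_of_abs_sub_le hx h
    have h3 : (0 : ℝ) < (B + E : ℕ) := lt_of_lt_of_le (by positivity) h1
    refine ⟨by exact_mod_cast h3, ?_, ?_⟩
    · rw [le_inv_mul_iff₀ hx, mul_comm]
      exact_mod_cast h1
    · rw [inv_mul_le_iff₀ hx, mul_comm x]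
      exact_mod_cast h2
  · intro x K ε hx hε
    have hh := tendsto_two_mul_div_two_pow K
    have hlo : Filter.Tendsto (fun s : ℕ => x - 2 * K / 2 ^ s) Filter.atTop (nhds x) := by
      simpa using hh.const_sub x
    have hhi : Filter.Tendsto (fun s : ℕ => x + 2 * K / 2 ^ s) Filter.atTop (nhds x) := by
      simpa using hh.const_add x
    have hdiff := (hlo.inv₀ hx.ne').sub (hhi.inv₀ hx.ne')
    rw [sub_self] at hdiff
    -- A stage at which the lower estimate is already positive and the gap between the inverses is
    -- below `ε`.
    obtain ⟨s, h1, h2⟩ :=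
      ((hlo.eventually_const_lt hx).and (hdiff.eventually_lt_const hε)).exists
    refine ⟨s, fun B E h hE => ?_⟩
    obtain ⟨h3, h4⟩ := bounds_div_of_abs_sub_le h hE
    have hs : (0 : ℝ) < 2 ^ s := by positivity
    have h5 : (0 : ℝ) < (B - E : ℕ) := by
      have := h1.trans_le h3
      exact (div_pos_iff_of_pos_right hs).1 this
    have h6 : (0 : ℝ) < (B + E : ℕ) :=
      lt_of_lt_of_le (by positivity) (bounds_of_abs_sub_le hx h).1
    refine ⟨by exact_mod_cast h5, ?_⟩
    have h7 := inv_anti₀ h1 h3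
    have h8 := inv_anti₀ (by positivity) h4
    rw [inv_div] at h7 h8
    push_cast at h8 ⊢
    linarith

theorem HasStagedEstimate.computableFromNorm_pow {f : NormedSetting.{u} → ℝ}
    (hf : HasStagedEstimate f) (hpos : ∀ D, 0 < f D) (n : ℕ) :
    ComputableFromNorm.{u} fun D => f D ^ n := by
  have hB : Primrec fun x : ℕ × ℕ × ℕ => x.2.1 := Primrec.fst.comp Primrec.snd
  have hE : Primrec fun x : ℕ × ℕ × ℕ => x.2.2 := Primrec.snd.comp Primrec.snd
  have hp : Primrec fun x : ℕ × ℕ × ℕ => (2 ^ x.1) ^ n :=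
    Primrec.nat_pow.comp (Primrec.nat_pow.comp (Primrec.const 2) Primrec.fst) (Primrec.const n)
  refine hf.computableFromNorm hpos (fun x => x ^ n)
    (bd := fun x => (((x.2.1 - x.2.2) ^ n, (2 ^ x.1) ^ n), ((x.2.1 + x.2.2) ^ n, (2 ^ x.1) ^ n)))
    (Primrec.pair
      (Primrec.pair (Primrec.nat_pow.comp (Primrec.nat_sub.comp hB hE) (Primrec.const n)) hp)
      (Primrec.pair (Primrec.nat_pow.comp (Primrec.nat_add.comp hB hE) (Primrec.const n)) hp))
    ?_ ?_
  · intro s B E x hx h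
    obtain ⟨h1, h2⟩ := bounds_of_abs_sub_le hx h
    have hx2 : x ^ n * ((2 : ℝ) ^ s) ^ n = (2 ^ s * x) ^ n := by rw [mul_pow, mul_comm]
    refine ⟨by positivity, ?_, ?_⟩
    · rw [Nat.cast_pow, Nat.cast_pow, Nat.cast_pow, Nat.cast_ofNat, hx2]
      exact pow_le_pow_left₀ (Nat.cast_nonneg _) h2 n
    · rw [Nat.cast_pow, Nat.cast_pow, Nat.cast_pow, Nat.cast_ofNat, hx2]
      exact pow_le_pow_left₀ (by positivity) h1 n
  · intro x K ε hx hε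
    have hh := tendsto_two_mul_div_two_pow K
    have hlo : Filter.Tendsto (fun s : ℕ => x - 2 * K / 2 ^ s) Filter.atTop (nhds x) := by
      simpa using hh.const_sub x
    have hhi : Filter.Tendsto (fun s : ℕ => x + 2 * K / 2 ^ s) Filter.atTop (nhds x) := by
      simpa using hh.const_add x
    have hdiff := (hhi.pow n).sub (hlo.pow n)
    rw [sub_self] at hdiff
    obtain ⟨s, h1, h2⟩ :=
      ((hlo.eventually_const_lt hx).and (hdiff.eventually_lt_const hε)).exists
    refine ⟨s, fun B E h hE => ⟨by positivity, ?_⟩⟩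
    obtain ⟨h3, h4⟩ := bounds_div_of_abs_sub_le h hE
    have h7 := pow_le_pow_left₀ h1.le h3 n
    have h8 := pow_le_pow_left₀ (by positivity) h4 n
    rw [div_pow] at h7 h8
    push_cast at h8 ⊢
    linarith

/-! ### The closest vector problem -/

/-- The comparisons that show that the vector with digits `z` is closest to `e_j`: its distance to
`e_j` is at most that of all vectors with `s + 1` digits, and at least `p ^ (-s) * N(e_i)` for
all `i`. -/
def comparisons (p m j s : ℕ) (z : List (List ℕ)) : List (FinVector × FinVector) :=
  ((digitTables p m (s + 1)).map fun z' => (diffVec m j 0 z, diffVec m j 0 z')) ++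
    (List.range m).map fun i => (diffVec m i 0 [], diffVec m j s z)

theorem primrec_digitComparisons : Primrec fun x : (ℕ × ℕ × ℕ) × ℕ × List (List ℕ) =>
    (digitTables x.1.1 x.1.2.1 (x.2.1 + 1)).map fun z =>
      (diffVec x.1.2.1 x.1.2.2 0 x.2.2, diffVec x.1.2.1 x.1.2.2 0 z) := by
  have hm : Primrec fun x : (ℕ × ℕ × ℕ) × ℕ × List (List ℕ) => x.1.2.1 :=
    Primrec.fst.comp (Primrec.snd.comp Primrec.fst)
  have hj : Primrec fun x : (ℕ × ℕ × ℕ) × ℕ × List (List ℕ) => x.1.2.2 :=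
    Primrec.snd.comp (Primrec.snd.comp Primrec.fst)
  have hs : Primrec fun x : (ℕ × ℕ × ℕ) × ℕ × List (List ℕ) => x.2.1 + 1 :=
    Primrec.succ.comp (Primrec.fst.comp Primrec.snd)
  have htab : Primrec fun x : (ℕ × ℕ × ℕ) × ℕ × List (List ℕ) =>
      digitTables x.1.1 x.1.2.1 (x.2.1 + 1) :=
    primrec_digitTables.comp (Primrec.pair (Primrec.fst.comp Primrec.fst) (Primrec.pair hm hs))
  have hself : Primrec fun x : (ℕ × ℕ × ℕ) × ℕ × List (List ℕ) =>
      diffVec x.1.2.1 x.1.2.2 0 x.2.2 :=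
    primrec_diffVec.comp (Primrec.pair hm
      (Primrec.pair hj (Primrec.pair (Primrec.const 0) (Primrec.snd.comp Primrec.snd))))
  have hother : Primrec fun y : ((ℕ × ℕ × ℕ) × ℕ × List (List ℕ)) × List (List ℕ) =>
      diffVec y.1.1.2.1 y.1.1.2.2 0 y.2 :=
    primrec_diffVec.comp (Primrec.pair (hm.comp Primrec.fst)
      (Primrec.pair (hj.comp Primrec.fst) (Primrec.pair (Primrec.const 0) Primrec.snd)))
  have hpair : Primrec₂ fun (x : (ℕ × ℕ × ℕ) × ℕ × List (List ℕ)) (z : List (List ℕ)) =>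
      (diffVec x.1.2.1 x.1.2.2 0 x.2.2, diffVec x.1.2.1 x.1.2.2 0 z) :=
    Primrec.pair (hself.comp Primrec.fst) hother
  exact Primrec.list_map htab hpair

theorem primrec_basisComparisons : Primrec fun x : (ℕ × ℕ × ℕ) × ℕ × List (List ℕ) =>
    (List.range x.1.2.1).map fun i =>
      (diffVec x.1.2.1 i 0 [], diffVec x.1.2.1 x.1.2.2 x.2.1 x.2.2) := by
  have hm : Primrec fun x : (ℕ × ℕ × ℕ) × ℕ × List (List ℕ) => x.1.2.1 :=
    Primrec.fst.comp (Primrec.snd.comp Primrec.fst)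
  have hscaled : Primrec fun x : (ℕ × ℕ × ℕ) × ℕ × List (List ℕ) =>
      diffVec x.1.2.1 x.1.2.2 x.2.1 x.2.2 :=
    primrec_diffVec.comp (Primrec.pair hm
      (Primrec.pair (Primrec.snd.comp (Primrec.snd.comp Primrec.fst)) Primrec.snd))
  have hbasis : Primrec fun y : ((ℕ × ℕ × ℕ) × ℕ × List (List ℕ)) × ℕ =>
      diffVec y.1.1.2.1 y.2 0 [] :=
    primrec_diffVec.comp (Primrec.pair (hm.comp Primrec.fst)
      (Primrec.pair Primrec.snd (Primrec.pair (Primrec.const 0) (Primrec.const []))))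
  have hpair : Primrec₂ fun (x : (ℕ × ℕ × ℕ) × ℕ × List (List ℕ)) (i : ℕ) =>
      (diffVec x.1.2.1 i 0 [], diffVec x.1.2.1 x.1.2.2 x.2.1 x.2.2) :=
    Primrec.pair hbasis (hscaled.comp Primrec.fst)
  exact Primrec.list_map (Primrec.list_range.comp hm) hpair

theorem primrec_comparisons : Primrec fun x : (ℕ × ℕ × ℕ) × ℕ × List (List ℕ) =>
    comparisons x.1.1 x.1.2.1 x.1.2.2 x.2.1 x.2.2 :=
  Primrec.list_append.comp primrec_digitComparisons primrec_basisComparisons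

theorem IsNormComparison.forall_comparisons_iff {D : NormedSetting.{u}}
    {O : FinVector × FinVector → Bool} (hO : D.IsNormComparison O) (j : Fin D.m) (s : ℕ)
    (z : List (List ℕ)) :
    (∀ b ∈ (comparisons D.p D.m j s z).map O, b = true) ↔
      (∀ z' ∈ digitTables D.p D.m (s + 1), D.N (D.e j - D.vec (digitVec D.m j z)) ≤
        D.N (D.e j - D.vec (digitVec D.m j z'))) ∧
      ∀ i : Fin D.m, D.N (D.e i) ≤ (D.p : ℝ) ^ s * D.N (D.e j - D.vec (digitVec D.m j z)) := by
  simp only [comparisons, List.map_append, List.map_map, List.forall_mem_append,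
    List.forall_mem_map, Function.comp_apply, List.mem_range]
  refine and_congr (forall₂_congr fun z _ => ?_) ⟨fun h i => ?_, fun h i hi => ?_⟩
  · rw [hO, D.vec_diffVec_zero, D.vec_diffVec_zero]
  · have := h i i.2
    rwa [hO, D.vec_diffVec_nil, D.norm_diffVec] at this
  · have := h ⟨i, hi⟩
    rw [hO, D.norm_diffVec]
    rwa [← D.vec_diffVec_nil ⟨i, hi⟩] at this

/-- By `h2`, truncation to `s + 1` digits moves any `v` by strictly less than `N (e_j - z)`; the
extra digit gives the strictness. As `z` is no worse than the truncation `z'`, the ultrametric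
inequality leaves only `N (e_j - z) ≤ N (e_j - v)`. -/
theorem closest_of_comparisons (D : NormedSetting.{u}) {j : Fin D.m} {s : ℕ} {z : List (List ℕ)}
    (h1 : ∀ z' ∈ digitTables D.p D.m (s + 1), D.N (D.e j - D.vec (digitVec D.m j z)) ≤
      D.N (D.e j - D.vec (digitVec D.m j z')))
    (h2 : ∀ i : Fin D.m,
      D.N (D.e i) ≤ (D.p : ℝ) ^ s * D.N (D.e j - D.vec (digitVec D.m j z)))
    (v : D.V) (hv : v ∈ D.otherLattice j) :
    D.N (D.e j - D.vec (digitVec D.m j z)) ≤ D.N (D.e j - v) := by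
  have hp := D.one_lt_p
  have hC := D.maxBasisNorm_pos
  obtain ⟨z', hz, hzN⟩ := D.exists_digitTable (s + 1) hv
  have h3 : D.maxBasisNorm ≤ (D.p : ℝ) ^ s * D.N (D.e j - D.vec (digitVec D.m j z)) :=
    ciSup_le h2
  have h4 : D.N (v - D.vec (digitVec D.m j z')) < D.N (D.e j - D.vec (digitVec D.m j z)) := by
    refine hzN.trans_lt ?_
    rw [pow_succ', mul_assoc, inv_pow]
    calc (D.p : ℝ)⁻¹ * (((D.p : ℝ) ^ s)⁻¹ * D.maxBasisNorm)
        < 1 * (((D.p : ℝ) ^ s)⁻¹ * D.maxBasisNorm) :=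
          mul_lt_mul_of_pos_right (inv_lt_one_of_one_lt₀ hp) (by positivity)
      _ = ((D.p : ℝ) ^ s)⁻¹ * D.maxBasisNorm := one_mul _
      _ ≤ _ := (inv_mul_le_iff₀ (by positivity)).2 h3
  have h5 := h1 z' hz
  rw [← sub_add_sub_cancel (D.e j) v (D.vec (digitVec D.m j z'))] at h5
  rcases le_max_iff.1 (h5.trans (D.isNorm.add_le_max _ _)) with h | h
  · exact h
  · exact absurd h (not_le.2 h4)

/-- For `s` large, truncating a closest vector moves it by less than the distance and so does not
increase the distance; its digits pass all comparisons. -/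
theorem exists_comparisons (D : NormedSetting.{u}) (j : Fin D.m) :
    ∃ (s : ℕ) (z : List (List ℕ)),
      (∀ z' ∈ digitTables D.p D.m (s + 1), D.N (D.e j - D.vec (digitVec D.m j z)) ≤
        D.N (D.e j - D.vec (digitVec D.m j z'))) ∧
      ∀ i : Fin D.m, D.N (D.e i) ≤ (D.p : ℝ) ^ s * D.N (D.e j - D.vec (digitVec D.m j z)) := by
  have hp := D.one_lt_p
  have hC := D.maxBasisNorm_pos
  obtain ⟨v₀, h₀, hmin⟩ := D.exists_closest j
  have hd : 0 < D.N (D.e j - v₀) := D.isNorm.pos (D.ne_of_mem_otherLattice h₀)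
  obtain ⟨s, hs⟩ := exists_pow_lt_of_lt_one (div_pos hd hC) (inv_lt_one_of_one_lt₀ hp)
  rw [lt_div_iff₀ hC] at hs
  obtain ⟨z, -, hzN⟩ := D.exists_digitTable (s + 1) h₀
  have hle : D.N (D.e j - D.vec (digitVec D.m j z)) ≤ D.N (D.e j - v₀) := by
    rw [← sub_add_sub_cancel _ v₀]
    refine (D.isNorm.add_le_max _ _).trans (max_le le_rfl (hzN.trans (le_trans ?_ hs.le)))
    exact mul_le_mul_of_nonneg_right (pow_le_pow_of_le_one (by positivity)
      (inv_le_one_of_one_le₀ hp.le) (Nat.le_succ s)) hC.le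
  refine ⟨s, z, fun z' _ => hle.trans (hmin _ (D.vec_digitVec_mem j z')), fun i => ?_⟩
  refine (D.norm_basis_le i).trans ?_
  rw [inv_pow, inv_mul_lt_iff₀ (by positivity)] at hs
  exact hs.le.trans
    (mul_le_mul_of_nonneg_left (hmin _ (D.vec_digitVec_mem j z)) (by positivity))

theorem exists_closestVector_algorithm :
    ∃ 𝒜 : OracleAlgorithm (ℕ × ℕ × ℕ) (FinVector × FinVector) Bool FinVector,
      ∀ (D : NormedSetting.{u}) (O : FinVector × FinVector → Bool), D.IsNormComparison O →
        ∀ j : Fin D.m, ∃ x : FinVector, 𝒜.Outputs O (D.p, D.m, (j : ℕ)) x ∧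
          D.vec x ∈ D.otherLattice j ∧
          D.N (D.e j - D.vec x) = normDist D.N (D.e j) (D.otherLattice j) := by
  -- The stage number codes a pair `(s, z)`, so the stages search all precisions and digit tables
  -- together.
  let st : (ℕ × ℕ × ℕ) × ℕ → (ℕ × ℕ × ℕ) × ℕ × List (List ℕ) := fun x =>
    (x.1, queryAt (ℕ × List (List ℕ)) x.2)
  have hst : Primrec st := Primrec.pair Primrec.fst (primrec_queryAt.comp Primrec.snd)
  have hqs := primrec_comparisons.comp hst
  have hbody : Primrec fun y : ((ℕ × ℕ × ℕ) × ℕ) × List Bool =>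
      if ∀ b ∈ y.2, b = true then some (digitVec y.1.1.2.1 y.1.1.2.2 (st y.1).2.2) else none := by
    have hall : PrimrecPred fun l : List Bool => ∀ b ∈ l, b = true :=
      PrimrecPred.forall_mem_list (Primrec.eq.comp Primrec.id (Primrec.const true))
    have hin : Primrec fun y : ((ℕ × ℕ × ℕ) × ℕ) × List Bool => y.1.1 :=
      Primrec.fst.comp Primrec.fst
    have hz : Primrec fun y : ((ℕ × ℕ × ℕ) × ℕ) × List Bool => (st y.1).2.2 :=
      Primrec.snd.comp (Primrec.snd.comp (hst.comp Primrec.fst))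
    have hout : Primrec fun y : ((ℕ × ℕ × ℕ) × ℕ) × List Bool =>
        digitVec y.1.1.2.1 y.1.1.2.2 (st y.1).2.2 :=
      primrec_digitVec.comp (Primrec.pair (Primrec.fst.comp (Primrec.snd.comp hin))
        (Primrec.pair (Primrec.snd.comp (Primrec.snd.comp hin)) hz))
    exact Primrec.ite (hall.comp Primrec.snd) (Primrec.option_some.comp hout) (Primrec.const none)
  obtain ⟨𝒜, h𝒜⟩ := exists_oracleAlgorithm_of_stages hqs hbody
  refine ⟨𝒜, fun D O hO j => h𝒜 O (D.p, D.m, (j : ℕ)) (fun x => D.vec x ∈ D.otherLattice j ∧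
    D.N (D.e j - D.vec x) = normDist D.N (D.e j) (D.otherLattice j)) (fun n x hx => ?_) ?_⟩
  · split_ifs at hx with hall
    rw [← Option.some_inj.1 hx]
    obtain ⟨h1, h2⟩ := (hO.forall_comparisons_iff j _ _).1 hall
    exact ⟨D.vec_digitVec_mem j _, D.normDist_eq_of_closest (D.vec_digitVec_mem j _)
      (D.closest_of_comparisons h1 h2)⟩
  · obtain ⟨s, z, h⟩ := D.exists_comparisons j
    have hsz : st ((D.p, D.m, (j : ℕ)), Encodable.encode (s, z)) = ((D.p, D.m, (j : ℕ)), s, z) :=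
      Prod.ext rfl (queryAt_encode _)
    refine ⟨Encodable.encode (s, z), ?_⟩
    rw [if_pos]
    · rfl
    · rw [hsz]
      exact (hO.forall_comparisons_iff j s z).2 h

end NormedSetting

theorem mainTheorem9 :
    -- `M` is a norm, the distances are attained, and the explicit constants are positive and work
    (∀ D : NormedSetting.{u},
      IsUltraNorm D.abv D.M ∧
      (∀ j, ∃ v₀ ∈ D.otherLattice j,
        D.N (D.e j - v₀) = normDist D.N (D.e j) (D.otherLattice j) ∧
        ∀ v ∈ D.otherLattice j, D.N (D.e j - v₀) ≤ D.N (D.e j - v)) ∧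
      0 < D.c₁ ∧ 0 < D.c₂ ∧
      ∀ v, D.c₁ * D.N v ≤ D.M v ∧ D.M v ≤ D.c₂ * D.N v) ∧
    -- both constants are computable from the norm
    NormedSetting.ComputableFromNorm.{u} (fun D => D.c₁) ∧
    NormedSetting.ComputableFromNorm.{u} (fun D => D.c₂) ∧
    -- one algorithm solves the CVP instances exactly, by comparing norms of vectors
    (∃ 𝒜 : OracleAlgorithm (ℕ × ℕ × ℕ) (FinVector × FinVector) Bool FinVector,
      ∀ (D : NormedSetting.{u}) (O : FinVector × FinVector → Bool), D.IsNormComparison O →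
        ∀ j : Fin D.m, ∃ x : FinVector, 𝒜.Outputs O (D.p, D.m, (j : ℕ)) x ∧
          D.vec x ∈ D.otherLattice j ∧
          D.N (D.e j - D.vec x) = normDist D.N (D.e j) (D.otherLattice j)) ∧
    -- the constants of the three Minkowski-type theorems are positive, work, and are computable
    (∀ D : NormedSetting.{u}, 0 < D.cFirst ∧ 0 < D.cTransfer ∧ (∀ n, 0 < D.cSecond n) ∧
      ∀ (n : ℕ) (hn : 0 < n) (B : Fin n → D.V), LinearIndependent D.K B →
        (∃ lam₁, IsGreatest (D.N '' latticeSpan D.abv B) lam₁ ∧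
          D.cFirst * D.latticeDet B ^ (1 / (n : ℝ)) ≤ lam₁) ∧
        (∀ lam mu : Fin n → ℝ,
          IsSuccessiveMaxima D.abv D.N (latticeSpan D.abv B) lam →
          IsSuccessiveMaxima D.abv D.N (D.dualLattice (latticeSpan D.abv B)) mu →
            D.cTransfer ≤ lam ⟨0, hn⟩ * mu ⟨n - 1, Nat.sub_lt hn Nat.one_pos⟩) ∧
        (∀ lam : Fin n → ℝ, IsSuccessiveMaxima D.abv D.N (latticeSpan D.abv B) lam →
          D.cSecond n * D.latticeDet B ≤ ∏ i, lam i)) ∧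
    NormedSetting.ComputableFromNorm.{u} (fun D => D.cFirst) ∧
    NormedSetting.ComputableFromNorm.{u} (fun D => D.cTransfer) ∧
    (∀ n : ℕ, NormedSetting.ComputableFromNorm.{u} (fun D => D.cSecond n)) := by
  have hd := NormedSetting.hasStagedEstimate_minBasisDist.{u}
  have hpos : ∀ D : NormedSetting.{u}, 0 < D.minBasisDist := fun D => D.minBasisDist_pos
  -- The three Minkowski constants are the powers `1`, `2` and `n` of `minBasisDist`.
  have hpow : ∀ n, NormedSetting.ComputableFromNorm.{u} fun D => D.cSecond n := fun n => by
    simpa [NormedSetting.cSecond, NormedSetting.c₂] using hd.computableFromNorm_pow hpos n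
  refine ⟨fun D => ⟨D.isUltraNorm_M, fun j => ?_, D.c₁_pos, D.c₂_pos,
      fun v => ⟨D.c₁_mul_le v, D.M_le_c₂_mul v⟩⟩,
    NormedSetting.hasStagedEstimate_maxBasisNorm.computableFromNorm_inv
      fun D => D.maxBasisNorm_pos,
    hd.computableFromNorm_inv hpos, NormedSetting.exists_closestVector_algorithm,
    fun D => ⟨one_div_pos.2 D.c₂_pos, one_div_pos.2 (pow_pos D.c₂_pos 2),
      fun n => one_div_pos.2 (pow_pos D.c₂_pos n), fun n hn B _ =>
        ⟨D.exists_isGreatest_norm hn B, D.cTransfer_le hn B, D.cSecond_mul_le B⟩⟩, ?_, hpow 2, hpow⟩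
  · obtain ⟨v₀, h₀, h⟩ := D.exists_closest j
    exact ⟨v₀, h₀, D.normDist_eq_of_closest h₀ h, h⟩
  · simpa [NormedSetting.cSecond, NormedSetting.cFirst] using hpow 1
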